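/- Let $X$ be a compact Riemann surface with canonical bundle $K_X$, so $K_X^{-1}=T^{1,0}X$, and let $g$ be a smooth Riemannian metric in its conformal class; in a local holomorphic coordinate $z=x+iy$ write $g=\rho\,dz\,d\bar z=\rho(dx^2+dy^2)$, with area measure $d\mu=\rho\,dx\,dy$ and Gauss curvature $K(g)=-\frac{1}{2\rho}(\partial_x^2+\partial_y^2)\log\rho$. Let $\beta=b\,d\bar z\otimes\partial_z$ be a smooth $(0,1)$-form with values in $T^{1,0}X$, and let $\lambda, C\in\mathbb R$. Norms: $|\partial u|_g^2=2|u_z|^2/\rho$ for real functions $u$ (that is, $|dz|_g^2=2/\rho$), and, for a fixed normalising constant $\kappa>0$, $|a\,dz^2|_g^2=\kappa|a|^2/\rho^2$ for quadratic differentials and $|b\,d\bar z\otimes\partial_z|_g^2=\kappa|b|^2$; all statements hold for every $\kappa>0$. Metric duals are $(f\,\partial_z)^*=\rho\bar f\,dz$ and $(b\,d\bar z\otimes\partial_z)^*=\rho\bar b\,dz^2$, and $\partial$ acts on a $(1,0)$-form $w\,dz$ through the Levi-Civita connection of $g$: $\partial(w\,dz)=\big(w_z-w\,(\log\rho)_z\big)dz^2$.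 For a smooth function $u:X\to\mathbb R$ and a smooth section $f$ of $T^{1,0}X$ put $$h=e^{2u}g,\qquad \alpha=e^{2u}(\beta^*+\partial f^*),$$ $$\mathcal D(u,f)=\int_X\Big[|\partial u|_g^2+K(g)\,u+e^{2u}\Big(-\frac{\lambda}{2}+|\beta+\bar\partial f|_g^2\Big)\Big]d\mu+C .$$ The integrand is integrable. We call $(u,f)$ a critical point of $\mathcal D$ if $\frac{d}{dt}\big|_{t=0}\mathcal D(u+tv,f+tw)$ exists and is $0$ for all smooth $v:X\to\mathbb R$ and all smooth sections $w$ of $T^{1,0}X$. Then: 1. $(u,f)$ is a critical point of $\mathcal D$ if and only if $(h,\alpha)$ solves the Gauss–Codazzi system, i.e. $\alpha$ is a holomorphic quadratic differential and $K(h)=\lambda-2|\alpha|_h^2$ on $X$. 2. $\frac{d}{dt}\big|_{t=0}\mathcal D(u,f+tw)=0$ for all smooth sections $w$ of $T^{1,0}X$ if and only if $\alpha$ is holomorphic. 3. $\frac{d}{dt}\big|_{t=0}\mathcal D(u+tv,f)=0$ for all smooth $v:X\to\mathbb R$ if and only if $K(h)=\lambda-2|\alpha|_h^2$ on $X$. 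-/

import Mathlib

open scoped Manifold ContDiff

noncomputable section

namespace CMC

/-- The Wirtinger derivative `∂F/∂z = (F_x - i F_y) / 2`. -/
def dz (F : ℂ → ℂ) (z : ℂ) : ℂ := (fderiv ℝ F z 1 - Complex.I * fderiv ℝ F z Complex.I) / 2

/-- The Wirtinger derivative `∂F/∂z̄ = (F_x + i F_y) / 2`. -/
def dzbar (F : ℂ → ℂ) (z : ℂ) : ℂ := (fderiv ℝ F z 1 + Complex.I * fderiv ℝ F z Complex.I) / 2

/-! ### Calculus facts needed for the transformation laws below -/

theorem fderiv_apply_eq (F : ℂ → ℂ) (z w : ℂ) :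
    fderiv ℝ F z w = dz F z * w + dzbar F z * (starRingEnd ℂ) w := by
  have h : fderiv ℝ F z w = (w.re : ℂ) * fderiv ℝ F z 1 + (w.im : ℂ) * fderiv ℝ F z Complex.I := by
    have hw : w = w.re • (1 : ℂ) + w.im • Complex.I := by
      simp [Complex.re_add_im]
    conv_lhs => rw [hw]
    rw [map_add, map_smul, map_smul]
    simp
  rw [h]
  have hre : (w.re : ℂ) = (w + (starRingEnd ℂ) w) / 2 := by
    rw [Complex.add_conj]; push_cast; ring
  have him : (w.im : ℂ) = -(Complex.I * (w - (starRingEnd ℂ) w)) / 2 := by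
    rw [Complex.sub_conj]; push_cast
    linear_combination (w.im : ℂ) * Complex.I_sq
  rw [hre, him]
  simp only [dz, dzbar]
  ring_nf

theorem dz_eq_of_hasFDerivAt {F : ℂ → ℂ} {z a b : ℂ} {L : ℂ →L[ℝ] ℂ} (h : HasFDerivAt F L z)
    (hL : ∀ w, L w = a * w + b * (starRingEnd ℂ) w) : dz F z = a ∧ dzbar F z = b := by
  have hI := Complex.I_sq
  simp only [dz, dzbar, h.fderiv, hL, map_one, Complex.conj_I]
  constructor
  · linear_combination (-(a - b) / 2) * hI
  · linear_combination ((a - b) / 2) * hI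

theorem dz_congr {F G : ℂ → ℂ} {z : ℂ} (h : F =ᶠ[nhds z] G) :
    dz F z = dz G z ∧ dzbar F z = dzbar G z := by
  simp only [dz, dzbar, h.fderiv_eq, and_self]

theorem dz_mul {F G : ℂ → ℂ} {z : ℂ} (hF : DifferentiableAt ℝ F z) (hG : DifferentiableAt ℝ G z) :
    dz (fun w => F w * G w) z = dz F z * G z + F z * dz G z ∧
      dzbar (fun w => F w * G w) z = dzbar F z * G z + F z * dzbar G z := by
  refine dz_eq_of_hasFDerivAt (hF.hasFDerivAt.mul hG.hasFDerivAt) fun w => ?_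
  simp only [add_apply, smul_apply, smul_eq_mul,
    fderiv_apply_eq]
  ring

theorem dz_add {F G : ℂ → ℂ} {z : ℂ} (hF : DifferentiableAt ℝ F z) (hG : DifferentiableAt ℝ G z) :
    dz (fun w => F w + G w) z = dz F z + dz G z ∧
      dzbar (fun w => F w + G w) z = dzbar F z + dzbar G z := by
  refine dz_eq_of_hasFDerivAt (hF.hasFDerivAt.add hG.hasFDerivAt) fun w => ?_
  simp only [add_apply, fderiv_apply_eq]
  ring

theorem dz_conj {F : ℂ → ℂ} {z : ℂ} (hF : DifferentiableAt ℝ F z) :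
    dz (fun w => (starRingEnd ℂ) (F w)) z = (starRingEnd ℂ) (dzbar F z) ∧
      dzbar (fun w => (starRingEnd ℂ) (F w)) z = (starRingEnd ℂ) (dz F z) := by
  have h : HasFDerivAt (fun w => (starRingEnd ℂ) (F w))
      ((Complex.conjCLE : ℂ →L[ℝ] ℂ).comp (fderiv ℝ F z)) z :=
    (Complex.conjCLE : ℂ →L[ℝ] ℂ).hasFDerivAt.comp z hF.hasFDerivAt
  refine dz_eq_of_hasFDerivAt h fun w => ?_
  simp [fderiv_apply_eq]
  ring

theorem dz_holomorphic {F : ℂ → ℂ} {z : ℂ} (hF : DifferentiableAt ℂ F z) :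
    dz F z = deriv F z ∧ dzbar F z = 0 := by
  refine dz_eq_of_hasFDerivAt hF.hasDerivAt.complexToReal_fderiv fun w => ?_
  simp

theorem dz_comp {F τ : ℂ → ℂ} {z : ℂ} (hF : DifferentiableAt ℝ F (τ z))
    (hτ : DifferentiableAt ℂ τ z) :
    dz (fun w => F (τ w)) z = dz F (τ z) * deriv τ z ∧
      dzbar (fun w => F (τ w)) z = dzbar F (τ z) * (starRingEnd ℂ) (deriv τ z) := by
  refine dz_eq_of_hasFDerivAt
    (hF.hasFDerivAt.comp z hτ.hasDerivAt.complexToReal_fderiv) fun w => ?_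
  simp [fderiv_apply_eq]
  ring

theorem contDiffOn_dz {F : ℂ → ℂ} {s : Set ℂ} (hs : IsOpen s) (hF : ContDiffOn ℝ ∞ F s) :
    ContDiffOn ℝ ∞ (dz F) s ∧ ContDiffOn ℝ ∞ (dzbar F) s := by
  have h : ContDiffOn ℝ ∞ (fderiv ℝ F) s := hF.fderiv_of_isOpen hs (by simp)
  have h1 : ContDiffOn ℝ ∞ (fun z => fderiv ℝ F z 1) s := h.clm_apply contDiffOn_const
  have hI : ContDiffOn ℝ ∞ (fun z => fderiv ℝ F z Complex.I) s := h.clm_apply contDiffOn_const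
  exact ⟨(h1.sub (contDiffOn_const.mul hI)).div_const 2,
    (h1.add (contDiffOn_const.mul hI)).div_const 2⟩

/-! ### Changes of coordinates on a Riemann surface

A Riemann surface is a complex manifold modelled on `ℂ`. -/

/-- The change of coordinates from `φ` to `ψ`. -/
def transition {X : Type*} [TopologicalSpace X] (φ ψ : OpenPartialHomeomorph X ℂ) (z : ℂ) : ℂ := ψ (φ.symm z)

/-- The part of the range of `φ` that corresponds to the intersection of the two domains. -/
def overlap {X : Type*} [TopologicalSpace X] (φ ψ : OpenPartialHomeomorph X ℂ) : Set ℂ := {z ∈ φ.target | φ.symm z ∈ ψ.source}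

theorem isOpen_overlap {X : Type*} [TopologicalSpace X] (φ ψ : OpenPartialHomeomorph X ℂ) : IsOpen (overlap φ ψ) :=
  φ.symm.isOpen_inter_preimage ψ.open_source

theorem transition_mem {X : Type*} [TopologicalSpace X] {φ ψ : OpenPartialHomeomorph X ℂ} {z : ℂ} (hz : z ∈ overlap φ ψ) :
    transition φ ψ z ∈ overlap ψ φ := by
  refine ⟨ψ.map_source hz.2, ?_⟩
  rw [transition, ψ.left_inv hz.2]
  exact φ.map_target hz.1

variable {X : Type*} [TopologicalSpace X] [ChartedSpace ℂ X]

theorem analyticAt_transition [IsManifold 𝓘(ℂ) ω X] {φ ψ : OpenPartialHomeomorph X ℂ}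
    (hφ : φ ∈ atlas ℂ X) (hψ : ψ ∈ atlas ℂ X) {z : ℂ} (hz : z ∈ overlap φ ψ) :
    AnalyticAt ℂ (transition φ ψ) z := by
  have h := ((contDiffGroupoid ω 𝓘(ℂ)).compatible hφ hψ).1
  have h2 : ContDiffOn ℂ ω (transition φ ψ) (overlap φ ψ) := by
    refine (h.mono ?_).congr ?_
    · intro w hw
      simpa [overlap] using hw
    · intro w _
      simp [transition]
  exact ((h2 z hz).contDiffAt ((isOpen_overlap φ ψ).mem_nhds hz)).analyticAt

theorem deriv_transition_ne_zero [IsManifold 𝓘(ℂ) ω X] {φ ψ : OpenPartialHomeomorph X ℂ}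
    (hφ : φ ∈ atlas ℂ X) (hψ : ψ ∈ atlas ℂ X) {z : ℂ} (hz : z ∈ overlap φ ψ) :
    deriv (transition φ ψ) z ≠ 0 := by
  have h1 := (analyticAt_transition hφ hψ hz).differentiableAt.hasDerivAt
  have h2 := (analyticAt_transition hψ hφ (transition_mem hz)).differentiableAt.hasDerivAt
  have h3 := h2.comp z h1
  have h4 : HasDerivAt (transition ψ φ ∘ transition φ ψ) 1 z := by
    refine (hasDerivAt_id z).congr_of_eventuallyEq ?_
    filter_upwards [(isOpen_overlap φ ψ).mem_nhds hz] with w hw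
    simp only [Function.comp, transition, id]
    rw [ψ.left_inv hw.2, φ.right_inv hw.1]
  intro h0
  have := h3.unique h4
  simp [h0] at this

theorem isManifold_real [IsManifold 𝓘(ℂ) ω X] : IsManifold 𝓘(ℝ, ℂ) ∞ X := by
  refine isManifold_of_contDiffOn 𝓘(ℝ, ℂ) ∞ X fun φ ψ hφ hψ => ?_
  have h := ((contDiffGroupoid ω 𝓘(ℂ)).compatible hφ hψ).1
  have h2 := ContDiffOn.restrict_scalars ℝ h
  exact (h2.of_le le_top).mono (by simp)

/-- A smooth real function is smooth in every coordinate. -/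
theorem contDiffOn_comp_symm [IsManifold 𝓘(ℂ) ω X] (u : C^∞⟮𝓘(ℝ, ℂ), X; ℝ⟯)
    {φ : OpenPartialHomeomorph X ℂ} (hφ : φ ∈ atlas ℂ X) :
    ContDiffOn ℝ ∞ (fun z => u (φ.symm z)) φ.target := by
  have : IsManifold 𝓘(ℝ, ℂ) ∞ X := isManifold_real
  have h := contMDiffOn_symm_of_mem_maximalAtlas (I := 𝓘(ℝ, ℂ)) (n := ∞)
    (IsManifold.subset_maximalAtlas hφ)
  exact (u.contMDiff.comp_contMDiffOn h).contDiffOn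

/-! ### Tensor fields in coordinates -/

variable (X) in
/-- A smooth section of the line bundle `K^p ⊗ K̄^q` over `X`, where `K` is the canonical bundle and
`K^(-1) = T^{1,0}X`: in every local coordinate `z` it is `c(z) dz^p dz̄^q` with a smooth complex
coefficient `c`, and the coefficients obey the transformation law under changes of coordinates.
The coefficient in the coordinate `φ` is a function on the range `φ.target`; its values elsewhere
have no meaning. -/
structure Tensor (p q : ℤ) where
  /-- The coefficient in a coordinate. -/
  coeff : OpenPartialHomeomorph X ℂ → ℂ → ℂ
  smooth : ∀ φ ∈ atlas ℂ X, ContDiffOn ℝ ∞ (coeff φ) φ.target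
  transform : ∀ φ ∈ atlas ℂ X, ∀ ψ ∈ atlas ℂ X, ∀ z ∈ overlap φ ψ,
    coeff φ z = coeff ψ (transition φ ψ z) *
      (deriv (transition φ ψ) z ^ p * (starRingEnd ℂ) (deriv (transition φ ψ) z) ^ q)

variable (X) in
/-- Smooth vector fields of type `(1,0)`: sections `f ∂/∂z` of `T^{1,0}X`. -/
abbrev VectorField := Tensor X (-1) 0

variable (X) in
/-- Smooth `(0,1)`-forms `b dz̄ ⊗ ∂/∂z` with values in `T^{1,0}X`. -/
abbrev BeltramiForm := Tensor X (-1) 1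

variable (X) in
/-- Smooth `(1,0)`-forms `ω dz`. -/
abbrev OneForm := Tensor X 1 0

variable (X) in
/-- Smooth quadratic differentials `a dz²`. -/
abbrev QuadraticDifferential := Tensor X 2 0

namespace Tensor

variable {p q : ℤ}

instance : Add (Tensor X p q) where
  add S T :=
    { coeff := fun φ z => S.coeff φ z + T.coeff φ z
      smooth := fun φ hφ => (S.smooth φ hφ).add (T.smooth φ hφ)
      transform := fun φ hφ ψ hψ z hz => by
        rw [S.transform φ hφ ψ hψ z hz, T.transform φ hφ ψ hψ z hz]; ring }

instance : SMul ℝ (Tensor X p q) where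
  smul t T :=
    { coeff := fun φ z => (t : ℂ) * T.coeff φ z
      smooth := fun φ hφ => contDiffOn_const.mul (T.smooth φ hφ)
      transform := fun φ hφ ψ hψ z hz => by
        rw [T.transform φ hφ ψ hψ z hz]; ring }

theorem differentiableAt (T : Tensor X p q) {φ : OpenPartialHomeomorph X ℂ} (hφ : φ ∈ atlas ℂ X)
    {z : ℂ} (hz : z ∈ φ.target) : DifferentiableAt ℝ (T.coeff φ) z :=
  ((T.smooth φ hφ).differentiableOn (by simp)).differentiableAt (φ.open_target.mem_nhds hz)

/-- The product `e^{2u} T`. -/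
def expMul [IsManifold 𝓘(ℂ) ω X] (u : C^∞⟮𝓘(ℝ, ℂ), X; ℝ⟯) (T : Tensor X p q) : Tensor X p q where
  coeff φ z := (Real.exp (2 * u (φ.symm z)) : ℂ) * T.coeff φ z
  smooth φ hφ := by
    have h : ContDiffOn ℝ ∞ (fun z => Real.exp (2 * u (φ.symm z))) φ.target :=
      (contDiffOn_const.mul (contDiffOn_comp_symm u hφ)).exp
    exact (Complex.ofRealCLM.contDiff.comp_contDiffOn h).mul (T.smooth φ hφ)
  transform φ hφ ψ hψ z hz := by
    rw [T.transform φ hφ ψ hψ z hz, transition, ψ.left_inv hz.2]; ring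

/-- The Cauchy–Riemann operator `∂̄` on sections of the holomorphic line bundle `K^p`. -/
def dbar [IsManifold 𝓘(ℂ) ω X] (T : Tensor X p 0) : Tensor X p 1 where
  coeff φ := dzbar (T.coeff φ)
  smooth φ hφ := (contDiffOn_dz φ.open_target (T.smooth φ hφ)).2
  transform φ hφ ψ hψ z hz := by
    have hτ := analyticAt_transition hφ hψ hz
    have hd : DifferentiableAt ℂ (fun w => deriv (transition φ ψ) w ^ p) z :=
      (hτ.deriv.zpow (n := p) (deriv_transition_ne_zero hφ hψ hz)).differentiableAt
    have hT := T.differentiableAt hψ (transition_mem hz).1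
    have he : T.coeff φ =ᶠ[nhds z] fun w =>
        T.coeff ψ (transition φ ψ w) * deriv (transition φ ψ) w ^ p := by
      filter_upwards [(isOpen_overlap φ ψ).mem_nhds hz] with w hw
      simpa using T.transform φ hφ ψ hψ w hw
    have hcomp : DifferentiableAt ℝ (fun w => T.coeff ψ (transition φ ψ w)) z :=
      hT.comp z hτ.differentiableAt.real_of_complex
    rw [(dz_congr he).2, (dz_mul hcomp hd.real_of_complex).2, (dz_holomorphic hd).2,
      (dz_comp hT hτ.differentiableAt).2]
    simp only [zpow_one]
    ring

/-- Holomorphic sections of `K^p`. -/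
def IsHolomorphic (T : Tensor X p 0) : Prop :=
  ∀ φ ∈ atlas ℂ X, DifferentiableOn ℂ (T.coeff φ) φ.target

end Tensor

/-- The `(1,0)`-form `∂u = u_z dz` of a real function `u`. -/
def del [IsManifold 𝓘(ℂ) ω X] (u : C^∞⟮𝓘(ℝ, ℂ), X; ℝ⟯) : OneForm X where
  coeff φ := dz fun w => (u (φ.symm w) : ℂ)
  smooth φ hφ := (contDiffOn_dz φ.open_target
    (Complex.ofRealCLM.contDiff.comp_contDiffOn (contDiffOn_comp_symm u hφ))).1
  transform φ hφ ψ hψ z hz := by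
    have hu : DifferentiableAt ℝ (fun w => (u (ψ.symm w) : ℂ)) (transition φ ψ z) :=
      ((Complex.ofRealCLM.contDiff.comp_contDiffOn
        (contDiffOn_comp_symm u hψ)).differentiableOn (by simp)).differentiableAt
          (ψ.open_target.mem_nhds (transition_mem hz).1)
    have he : (fun w => (u (φ.symm w) : ℂ)) =ᶠ[nhds z]
        fun w => (u (ψ.symm (transition φ ψ w)) : ℂ) := by
      filter_upwards [(isOpen_overlap φ ψ).mem_nhds hz] with w hw
      rw [transition, ψ.left_inv hw.2]
    rw [(dz_congr he).1,
      (dz_comp hu (analyticAt_transition hφ hψ hz).differentiableAt).1]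
    simp

/-! ### Metrics -/

variable (X) in
/-- A smooth Riemannian metric on `X` in the conformal class given by the complex structure: in every
local coordinate `z = x + i y` it is `ρ(z) dz dz̄ = ρ (dx² + dy²)` with a smooth function `ρ > 0`. -/
structure ConformalMetric where
  /-- The coefficient of `dz dz̄ = dx² + dy²` in a coordinate. -/
  ρ : OpenPartialHomeomorph X ℂ → ℂ → ℝ
  pos : ∀ φ ∈ atlas ℂ X, ∀ z ∈ φ.target, 0 < ρ φ z
  smooth : ∀ φ ∈ atlas ℂ X, ContDiffOn ℝ ∞ (ρ φ) φ.target
  transform : ∀ φ ∈ atlas ℂ X, ∀ ψ ∈ atlas ℂ X, ∀ z ∈ overlap φ ψ,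
    ρ φ z = ρ ψ (transition φ ψ z) * ‖deriv (transition φ ψ) z‖ ^ 2

namespace ConformalMetric

theorem smooth_ofReal (g : ConformalMetric X) {φ : OpenPartialHomeomorph X ℂ}
    (hφ : φ ∈ atlas ℂ X) : ContDiffOn ℝ ∞ (fun z => (g.ρ φ z : ℂ)) φ.target :=
  Complex.ofRealCLM.contDiff.comp_contDiffOn (g.smooth φ hφ)

theorem transform_ofReal (g : ConformalMetric X) {φ ψ : OpenPartialHomeomorph X ℂ}
    (hφ : φ ∈ atlas ℂ X) (hψ : ψ ∈ atlas ℂ X) {z : ℂ} (hz : z ∈ overlap φ ψ) :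
    (g.ρ φ z : ℂ) = (g.ρ ψ (transition φ ψ z) : ℂ) *
      (deriv (transition φ ψ) z * (starRingEnd ℂ) (deriv (transition φ ψ) z)) := by
  rw [g.transform φ hφ ψ hψ z hz, Complex.mul_conj, Complex.normSq_eq_norm_sq]
  push_cast
  rfl

/-- The metric `e^{2u} g`. -/
def expMul [IsManifold 𝓘(ℂ) ω X] (u : C^∞⟮𝓘(ℝ, ℂ), X; ℝ⟯) (g : ConformalMetric X) :
    ConformalMetric X where
  ρ φ z := Real.exp (2 * u (φ.symm z)) * g.ρ φ z
  pos φ hφ z hz := mul_pos (Real.exp_pos _) (g.pos φ hφ z hz)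
  smooth φ hφ := (contDiffOn_const.mul (contDiffOn_comp_symm u hφ)).exp.mul (g.smooth φ hφ)
  transform φ hφ ψ hψ z hz := by
    rw [g.transform φ hφ ψ hψ z hz, transition, ψ.left_inv hz.2]; ring

/-- The Gauss curvature `K = -(Δ log ρ) / (2 ρ)` of the metric `ρ (dx² + dy²)`, in the preferred coordinate at `x`. -/
def curvature (g : ConformalMetric X) (x : X) : ℝ :=
  -Laplacian.laplacian (fun w => Real.log (g.ρ (chartAt ℂ x) w)) (chartAt ℂ x x) /
    (2 * g.ρ (chartAt ℂ x) (chartAt ℂ x x))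

/-- The area measure `dμ = ρ dx dy` of the metric. Every coordinate `φ` carries a measure
on its domain, the image of `ρ dx dy` under `φ⁻¹`; these measures agree where two domains
meet, and their supremum is the measure on `X` that restricts to each of them. -/
def area [MeasurableSpace X] (g : ConformalMetric X) : MeasureTheory.Measure X :=
  ⨆ φ ∈ atlas ℂ X, ((MeasureTheory.volume.restrict φ.target).withDensity
    fun z => ENNReal.ofReal (g.ρ φ z)).map φ.symm

end ConformalMetric

namespace Tensor

variable {p q : ℤ}

/-- The squared pointwise norm of a section of `K^p ⊗ K̄^q` in the metric `g`,
`|c dz^p dz̄^q|² = κ |c|² / ρ^(p+q)`. The constant `κ > 0` is the normalisation of the norm: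
on `(1,0)`-forms the Hermitian extension of `g` has `|dz|² = |dx + i dy|² = 2/ρ`, so `κ = 2`; for
quadratic differentials `κ = 4` gives `|dz ⊗ dz|² = |dz|⁴`, whereas with `κ = 2` the equation
`K = k + c² - 2 |α|²` is the Gauss equation of the second fundamental form `α + c h + ᾱ`.
With the same `κ`, `β` and its dual `β*` have equal norms. -/
def normSq (κ : ℝ) (g : ConformalMetric X) (T : Tensor X p q) (x : X) : ℝ :=
  κ * ‖T.coeff (chartAt ℂ x) (chartAt ℂ x x)‖ ^ 2 / g.ρ (chartAt ℂ x) (chartAt ℂ x x) ^ (p + q)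

/-- The metric dual `T ↦ T*`, which conjugates the coefficient and lowers the upper index with `ρ`:
`f ∂/∂z ↦ ρ f̄ dz` for `q = 0` and `b dz̄ ⊗ ∂/∂z ↦ ρ b̄ dz²` for `q = 1`. -/
def conjDual [IsManifold 𝓘(ℂ) ω X] (g : ConformalMetric X) (T : Tensor X (-1) q) : Tensor X (q + 1) 0 where
  coeff φ z := (g.ρ φ z : ℂ) * (starRingEnd ℂ) (T.coeff φ z)
  smooth φ hφ := (g.smooth_ofReal hφ).mul
    ((Complex.conjCLE : ℂ →L[ℝ] ℂ).contDiff.comp_contDiffOn (T.smooth φ hφ))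
  transform φ hφ ψ hψ z hz := by
    have h0 := deriv_transition_ne_zero hφ hψ hz
    have h1 : (starRingEnd ℂ) (deriv (transition φ ψ) z) ≠ 0 := by simpa using h0
    rw [g.transform_ofReal hφ hψ hz, T.transform φ hφ ψ hψ z hz, zpow_add₀ h0]
    simp only [map_mul, map_zpow₀, Complex.conj_conj, zpow_one, zpow_neg, zpow_zero, map_inv₀]
    field_simp

end Tensor

/-- The dual `f* = ρ f̄ dz` of a vector field `f ∂/∂z`. -/
def VectorField.dual [IsManifold 𝓘(ℂ) ω X] (g : ConformalMetric X) (f : VectorField X) :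
    OneForm X := Tensor.conjDual g f

/-- The dual `β* = ρ b̄ dz²` of `β = b dz̄ ⊗ ∂/∂z`. -/
def BeltramiForm.dual [IsManifold 𝓘(ℂ) ω X] (g : ConformalMetric X) (β : BeltramiForm X) :
    QuadraticDifferential X := Tensor.conjDual g β

/-- The covariant derivative `∂ω = (ω_z - ω (log ρ)_z) dz²` of a `(1,0)`-form `ω dz`: the `(1,0)`-part
of the Levi-Civita connection of `g`, whose Christoffel symbol is `(log ρ)_z`. -/
def covDel [IsManifold 𝓘(ℂ) ω X] (g : ConformalMetric X) (T : OneForm X) :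
    QuadraticDifferential X where
  coeff φ z := dz (T.coeff φ) z - T.coeff φ z * (dz (fun w => (g.ρ φ w : ℂ)) z / (g.ρ φ z : ℂ))
  smooth φ hφ := by
    have h0 : ∀ z ∈ φ.target, (g.ρ φ z : ℂ) ≠ 0 := fun z hz =>
      Complex.ofReal_ne_zero.2 (g.pos φ hφ z hz).ne'
    have h : ContDiffOn ℝ ∞ (fun z => dz (fun w => (g.ρ φ w : ℂ)) z / (g.ρ φ z : ℂ)) φ.target := by
      simp only [div_eq_mul_inv]
      exact (contDiffOn_dz φ.open_target (g.smooth_ofReal hφ)).1.mul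
        ((g.smooth_ofReal hφ).inv h0)
    exact (contDiffOn_dz φ.open_target (T.smooth φ hφ)).1.sub ((T.smooth φ hφ).mul h)
  transform φ hφ ψ hψ z hz := by
    have hτ := analyticAt_transition hφ hψ hz
    have hτ' := hτ.deriv.differentiableAt
    have h0 := deriv_transition_ne_zero hφ hψ hz
    have h1 : (starRingEnd ℂ) (deriv (transition φ ψ) z) ≠ 0 := by simpa using h0
    have hm := (transition_mem hz).1
    have hρ0 : (g.ρ ψ (transition φ ψ z) : ℂ) ≠ 0 := by exact_mod_cast (g.pos ψ hψ _ hm).ne'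
    have hT := T.differentiableAt hψ hm
    have hρ : DifferentiableAt ℝ (fun w => (g.ρ ψ w : ℂ)) (transition φ ψ z) :=
      ((g.smooth_ofReal hψ).differentiableOn (by simp)).differentiableAt
        (ψ.open_target.mem_nhds hm)
    have hconj : DifferentiableAt ℝ
        (fun w => (starRingEnd ℂ) (deriv (transition φ ψ) w)) z :=
      (Complex.conjCLE : ℂ →L[ℝ] ℂ).differentiableAt.comp z hτ'.real_of_complex
    have hmul : DifferentiableAt ℝ (fun w => deriv (transition φ ψ) w *
        (starRingEnd ℂ) (deriv (transition φ ψ) w)) z := hτ'.real_of_complex.mul hconj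
    have hcT : DifferentiableAt ℝ (fun w => T.coeff ψ (transition φ ψ w)) z :=
      hT.comp z hτ.differentiableAt.real_of_complex
    have hcρ : DifferentiableAt ℝ (fun w => (g.ρ ψ (transition φ ψ w) : ℂ)) z :=
      hρ.comp z hτ.differentiableAt.real_of_complex
    have heT : T.coeff φ =ᶠ[nhds z] fun w =>
        T.coeff ψ (transition φ ψ w) * deriv (transition φ ψ) w := by
      filter_upwards [(isOpen_overlap φ ψ).mem_nhds hz] with w hw
      simpa using T.transform φ hφ ψ hψ w hw
    have heρ : (fun w => (g.ρ φ w : ℂ)) =ᶠ[nhds z] fun w =>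
        (g.ρ ψ (transition φ ψ w) : ℂ) *
          (deriv (transition φ ψ) w * (starRingEnd ℂ) (deriv (transition φ ψ) w)) := by
      filter_upwards [(isOpen_overlap φ ψ).mem_nhds hz] with w hw
      exact g.transform_ofReal hφ hψ hw
    rw [(dz_congr heT).1, (dz_congr heρ).1, heT.eq_of_nhds, g.transform_ofReal hφ hψ hz,
      (dz_mul hcT hτ'.real_of_complex).1,
      (dz_mul hcρ hmul).1, (dz_mul hτ'.real_of_complex hconj).1,
      (dz_conj hτ'.real_of_complex).1, (dz_holomorphic hτ').1, (dz_holomorphic hτ').2,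
      (dz_comp hT hτ.differentiableAt).1, (dz_comp hρ hτ.differentiableAt).1]
    simp only [map_zero, zpow_ofNat]
    field_simp
    ring

/-! ### The functional and the equations -/

section Functional

open MeasureTheory

variable [IsManifold 𝓘(ℂ) ω X]

/-- The integrand `|∂u|² + K(g) u + e^{2u} (-λ/2 + |β + ∂̄f|²)`, with all terms computed in the
metric `g`. Here `|dz|² = 2/ρ`, the norm of `dz = dx + i dy` in the Hermitian extension of `g`. -/
def integrand (κ lam : ℝ) (g : ConformalMetric X) (β : BeltramiForm X)
    (u : C^∞⟮𝓘(ℝ, ℂ), X; ℝ⟯) (f : VectorField X) (x : X) : ℝ :=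
  (del u).normSq 2 g x + g.curvature x * u x +
    Real.exp (2 * u x) * (-lam / 2 + (β + f.dbar).normSq κ g x)

/-- The functional `𝒟(u, f)`, with the additive constant `C`. -/
def donaldson [MeasurableSpace X] (κ lam C : ℝ) (g : ConformalMetric X) (β : BeltramiForm X)
    (u : C^∞⟮𝓘(ℝ, ℂ), X; ℝ⟯) (f : VectorField X) : ℝ :=
  (∫ x, integrand κ lam g β u f x ∂g.area) + C

/-- `(u, f)` is a critical point of `D` : all directional derivatives vanish there. -/
def IsCritical (D : C^∞⟮𝓘(ℝ, ℂ), X; ℝ⟯ → VectorField X → ℝ)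
    (u : C^∞⟮𝓘(ℝ, ℂ), X; ℝ⟯) (f : VectorField X) : Prop :=
  ∀ (v : C^∞⟮𝓘(ℝ, ℂ), X; ℝ⟯) (w : VectorField X),
    HasDerivAt (fun t : ℝ => D (u + t • v) (f + t • w)) 0 0

/-- The Gauss equation `K(h) = λ - 2 |α|²_h`. -/
def GaussEquation (κ lam : ℝ) (h : ConformalMetric X) (α : QuadraticDifferential X) : Prop :=
  ∀ x, h.curvature x = lam - 2 * α.normSq κ h x

/-- The Gauss–Codazzi system for `(h, α)`: the quadratic differential `α` is holomorphic and the
Gauss equation holds. -/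
def GaussCodazzi (κ lam : ℝ) (h : ConformalMetric X) (α : QuadraticDifferential X) : Prop :=
  α.IsHolomorphic ∧ GaussEquation κ lam h α

/-- The quadratic differential `e^{2u} (β* + ∂f*)`. -/
def hopf (g : ConformalMetric X) (β : BeltramiForm X) (u : C^∞⟮𝓘(ℝ, ℂ), X; ℝ⟯)
    (f : VectorField X) : QuadraticDifferential X :=
  Tensor.expMul u (β.dual g + covDel g (f.dual g))

end Functional

end CMC

end

noncomputable section
namespace CMC
variable {X : Type*} [TopologicalSpace X] [ChartedSpace ℂ X]

/-! ### The area measure: gluing over coordinates, finiteness, positivity on open sets -/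

section Area

open MeasureTheory

/-! The theorem rests on one first-variation formula: with `α = hopf g β u f` and `h = e^{2u} g`,
the derivative of the functional in the direction `(v, w)` is `∫ v · e^{2u} (K(h) - λ + 2|α|²_h) dμ
- 2κ Re ∫ (∂̄α · w)`, where the `(1,1)`-form `∂̄α · w` is integrated through its density against
`dμ`.

Three pointwise identities produce it. The Levi-Civita correction in `∂f*` cancels the derivative of
`ρ`, so `α` is `e^{2u}` times the metric dual of `β + ∂̄f` (`hopf_coeff`). Consequently `|α|²_h = |β
+ ∂̄f|²_g` (`normSq_hopf`). Finally `e^{2u} K(h) = K(g) - Δu/ρ` (`curvature_expMul`). Together they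
show that the derivative of the integrand equals the integrand of the formula plus multiples of the
real densities of `∂̄(v ∂u)` and `∂̄(α · w)` (`integrandDeriv_eq`). These exact terms integrate to
zero by Stokes on the closed surface (`Tensor.integral_density_dbar`).

The Gauss–Codazzi equations thus make every derivative vanish. Conversely, `v` may be taken to be
the Gauss defect itself and `w` the metric dual of `∂̄α`. The two integrals then become integrals of
a square and of `|∂̄α|²`; a continuous nonnegative function with zero integral vanishes, because the
area measure is positive on nonempty open sets.

Underneath lies the check that norms, curvature and area do not depend on the coordinate, although
the first two are defined in the preferred chart at each point and the third as a supremum over the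
atlas. -/

theorem measurableSet_symm_preimage {Y : Type*} [TopologicalSpace Y] [MeasurableSpace Y]
    [BorelSpace Y] (φ : OpenPartialHomeomorph Y ℂ) {S : Set Y} (hS : MeasurableSet S) :
    MeasurableSet (φ.symm ⁻¹' S ∩ φ.target) := by
  have h : MeasurableSet ((Subtype.val : φ.target → ℂ) '' (φ.target.domRestrict φ.symm ⁻¹' S)) :=
    (φ.open_target.measurableSet).subtype_image
      ((continuousOn_iff_continuous_domRestrict.1 φ.continuousOn_symm).measurable hS)
  convert h using 1
  ext z
  simp [and_comm, Set.domRestrict]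

theorem aemeasurable_symm_withDensity {Y : Type*} [TopologicalSpace Y] [MeasurableSpace Y]
    [BorelSpace Y] (φ : OpenPartialHomeomorph Y ℂ) (d : ℂ → ENNReal) :
    AEMeasurable φ.symm ((volume.restrict φ.target).withDensity d) :=
  (φ.continuousOn_symm.aemeasurable φ.open_target.measurableSet).mono_ac
    (withDensity_absolutelyContinuous _ _)

namespace ConformalMetric

/-- The area measure of `g` on the domain of a single coordinate. -/
def chartArea [MeasurableSpace X] (g : ConformalMetric X) (φ : OpenPartialHomeomorph X ℂ) :
    Measure X :=
  ((volume.restrict φ.target).withDensity fun z => ENNReal.ofReal (g.ρ φ z)).map φ.symm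

variable [MeasurableSpace X] [BorelSpace X] (g : ConformalMetric X)

theorem chartArea_apply (φ : OpenPartialHomeomorph X ℂ) {S : Set X} (hS : MeasurableSet S) :
    g.chartArea φ S = ∫⁻ z in φ.symm ⁻¹' S ∩ φ.target, ENNReal.ofReal (g.ρ φ z) := by
  rw [chartArea, Measure.map_apply_of_aemeasurable (aemeasurable_symm_withDensity φ _) hS,
    withDensity_apply', Measure.restrict_restrict' φ.open_target.measurableSet]

theorem chartArea_compl_source (φ : OpenPartialHomeomorph X ℂ) :
    g.chartArea φ φ.sourceᶜ = 0 := by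
  rw [chartArea_apply g φ φ.open_source.measurableSet.compl]
  have : φ.symm ⁻¹' φ.sourceᶜ ∩ φ.target = ∅ := by
    ext z
    simp only [Set.mem_inter_iff, Set.mem_preimage, Set.mem_compl_iff, Set.mem_empty_iff_false,
      iff_false, not_and]
    exact fun h hz => h (φ.map_target hz)
  rw [this]
  simp

/-- The real determinant of multiplication by `c` is the algebra norm of `ℂ` over `ℝ`. It is the
Jacobian factor for holomorphic changes of variable. -/
theorem abs_det_toSpanSingleton_complex (c : ℂ) :
    |((ContinuousLinearMap.toSpanSingleton ℂ c).restrictScalars ℝ).det| = ‖c‖ ^ 2 := by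
  have h : (((ContinuousLinearMap.toSpanSingleton ℂ c).restrictScalars ℝ : ℂ →L[ℝ] ℂ) :
      ℂ →ₗ[ℝ] ℂ) = Algebra.lmul ℝ ℂ c := by
    ext
    simp [mul_comm]
  rw [ContinuousLinearMap.det, h]
  have := congrArg (fun f => f c) Algebra.norm_complex_eq
  simp only [Algebra.norm_apply] at this
  rw [this]
  simp [Complex.normSq_eq_norm_sq]

/-- The Jacobian `|τ'|²` of the holomorphic transition `τ` is exactly the factor by which `ρ`
transforms, so change of variables carries one integral to the other. -/
theorem chartArea_congr [IsManifold 𝓘(ℂ) ω X] {φ ψ : OpenPartialHomeomorph X ℂ}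
    (hφ : φ ∈ atlas ℂ X) (hψ : ψ ∈ atlas ℂ X) {S : Set X} (hS : MeasurableSet S)
    (h1 : S ⊆ φ.source) (h2 : S ⊆ ψ.source) : g.chartArea φ S = g.chartArea ψ S := by
  rw [chartArea_apply g φ hS, chartArea_apply g ψ hS]
  have hsub : φ.symm ⁻¹' S ∩ φ.target ⊆ overlap φ ψ := fun z hz => ⟨hz.2, h2 hz.1⟩
  have him : ψ.symm ⁻¹' S ∩ ψ.target = transition φ ψ '' (φ.symm ⁻¹' S ∩ φ.target) := by
    ext z
    constructor
    · rintro ⟨hz, hzt⟩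
      refine ⟨φ (ψ.symm z), ⟨?_, φ.map_source (h1 hz)⟩, ?_⟩
      · rw [Set.mem_preimage, φ.left_inv (h1 hz)]; exact hz
      · rw [transition, φ.left_inv (h1 hz), ψ.right_inv hzt]
    · rintro ⟨w, ⟨hw, hwt⟩, rfl⟩
      refine ⟨?_, ψ.map_source (h2 hw)⟩
      rw [Set.mem_preimage, transition, ψ.left_inv (h2 hw)]; exact hw
  have hinj : Set.InjOn (transition φ ψ) (φ.symm ⁻¹' S ∩ φ.target) := by
    intro z hz w hw h
    have := ψ.injOn (h2 hz.1) (h2 hw.1) h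
    exact φ.symm.injOn hz.2 hw.2 this
  rw [him, lintegral_image_eq_lintegral_abs_det_fderiv_mul volume
    (measurableSet_symm_preimage φ hS) (f' := fun z =>
      (ContinuousLinearMap.toSpanSingleton ℂ (deriv (transition φ ψ) z)).restrictScalars ℝ) ?_ hinj]
  · refine setLIntegral_congr_fun (measurableSet_symm_preimage φ hS) fun z hz => ?_
    rw [abs_det_toSpanSingleton_complex, ← ENNReal.ofReal_mul (by positivity),
      g.transform φ hφ ψ hψ z (hsub hz), mul_comm]
  · intro z hz
    exact ((analyticAt_transition hφ hψ (hsub hz)).differentiableAt.hasDerivAt.hasFDerivAt.restrictScalars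
      ℝ).hasFDerivWithinAt

/-- The supremum is identified with a measure `ν` glued from chart measures on disjoint pieces. This
`ν` restricts to each chart measure by `chartArea_congr`, and no measure dominating all chart
measures can be smaller than `ν`. -/
theorem restrict_area [IsManifold 𝓘(ℂ) ω X] [CompactSpace X] {φ : OpenPartialHomeomorph X ℂ}
    (hφ : φ ∈ atlas ℂ X) : g.area.restrict φ.source = g.chartArea φ := by
  classical
  obtain ⟨t, ht⟩ := isCompact_univ.elim_finite_subcover (fun x : X => (chartAt ℂ x).source)
    (fun x => (chartAt ℂ x).open_source) fun x _ => Set.mem_iUnion.2 ⟨x, mem_chart_source ℂ x⟩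
  let e := t.equivFin.symm
  -- The finite cover is listed as a sequence so that `disjointed` applies; the remaining indices
  -- are filled with `φ`, which also covers the case of an empty list.
  let c : ℕ → OpenPartialHomeomorph X ℂ := fun n =>
    if h : n < t.card then chartAt ℂ (e ⟨n, h⟩ : X) else φ
  have hc : ∀ n, c n ∈ atlas ℂ X := by
    intro n
    simp only [c]
    split_ifs
    · exact chart_mem_atlas ℂ _
    · exact hφ
  have hcov : ⋃ n, (c n).source = Set.univ := by
    refine Set.eq_univ_of_forall fun x => ?_
    obtain ⟨y, hy, hxy⟩ := Set.mem_iUnion₂.1 (ht (Set.mem_univ x))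
    refine Set.mem_iUnion.2 ⟨(e.symm ⟨y, hy⟩), ?_⟩
    simpa [c] using hxy
  let D : ℕ → Set X := disjointed fun n => (c n).source
  have hD : ∀ n, MeasurableSet (D n) :=
    fun n => MeasurableSet.disjointed (fun n => (c n).open_source.measurableSet) n
  have hDs : ∀ n, D n ⊆ (c n).source := fun n => disjointed_subset _ n
  have hDcov : ⋃ n, D n = Set.univ := by rw [iUnion_disjointed, hcov]
  have hDd : Pairwise (Function.onFun Disjoint D) := disjoint_disjointed _
  let ν : Measure X := Measure.sum fun n => (g.chartArea (c n)).restrict (D n)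
  have hle : ∀ ψ ∈ atlas ℂ X, g.chartArea ψ = ν.restrict ψ.source := by
    intro ψ hψ
    ext S hS
    rw [Measure.restrict_apply hS, Measure.sum_apply _ (hS.inter ψ.open_source.measurableSet)]
    have h1 : g.chartArea ψ S = g.chartArea ψ (S ∩ ψ.source) := by
      refine (measure_inter_conull ?_).symm
      exact g.chartArea_compl_source ψ
    have h2 : S ∩ ψ.source = ⋃ n, (S ∩ ψ.source) ∩ D n := by
      rw [← Set.inter_iUnion, hDcov, Set.inter_univ]
    have hm := hS.inter ψ.open_source.measurableSet
    rw [h1]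
    conv_lhs => rw [h2]
    rw [measure_iUnion (fun i j hij => (hDd hij).mono Set.inter_subset_right Set.inter_subset_right)
      fun n => hm.inter (hD n)]
    refine tsum_congr fun n => ?_
    rw [Measure.restrict_apply hm]
    exact g.chartArea_congr hψ (hc n) (hm.inter (hD n))
      (fun x hx => hx.1.2) (fun x hx => hDs n hx.2)
  have harea : g.area = ν := by
    refine le_antisymm (iSup₂_le fun ψ hψ => ?_) ?_
    · exact (hle ψ hψ).le.trans Measure.restrict_le_self
    -- For the reverse inequality it suffices to compare on each `D n`, where `ν` is the chart
    -- measure of `c n`, one of the members of the supremum.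
    · have : g.area = Measure.sum fun n => g.area.restrict (D n) := by
        rw [← Measure.restrict_iUnion hDd hD, hDcov, Measure.restrict_univ]
      rw [this]
      refine Measure.le_iff.2 fun S hS => ?_
      rw [Measure.sum_apply _ hS, Measure.sum_apply _ hS]
      refine ENNReal.tsum_le_tsum fun n => ?_
      refine Measure.restrict_mono le_rfl (?_ : g.chartArea (c n) ≤ g.area) S
      exact le_iSup₂ (f := fun ψ (_ : ψ ∈ atlas ℂ X) => g.chartArea ψ) (c n) (hc n)
  rw [harea, hle φ hφ]

theorem integral_source [IsManifold 𝓘(ℂ) ω X] [CompactSpace X] {φ : OpenPartialHomeomorph X ℂ}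
    (hφ : φ ∈ atlas ℂ X) {G : X → ℂ} (hG : Continuous G) :
    ∫ x in φ.source, G x ∂g.area = ∫ z in φ.target, (g.ρ φ z : ℂ) * G (φ.symm z) := by
  rw [g.restrict_area hφ, chartArea, integral_map (aemeasurable_symm_withDensity φ _)
    hG.aestronglyMeasurable, integral_withDensity_eq_integral_toReal_smul₀]
  · refine setIntegral_congr_fun φ.open_target.measurableSet fun z hz => ?_
    rw [ENNReal.toReal_ofReal (g.pos φ hφ z hz).le]
    simp
  · exact ((g.smooth φ hφ).continuousOn.aemeasurable φ.open_target.measurableSet).ennreal_ofReal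
  · exact Filter.Eventually.of_forall fun z => ENNReal.ofReal_lt_top

instance isFiniteMeasure_area [IsManifold 𝓘(ℂ) ω X] [CompactSpace X] :
    IsFiniteMeasure g.area := by
  have hloc : IsLocallyFiniteMeasure g.area := by
    refine ⟨fun x => ?_⟩
    set φ := chartAt ℂ x
    have hφ : φ ∈ atlas ℂ X := chart_mem_atlas ℂ x
    have hx : φ x ∈ φ.target := mem_chart_target ℂ x
    -- `ρ` may be unbounded near the boundary of `φ.target`, so the neighbourhood is shrunk into a
    -- compact set.
    obtain ⟨K, hK, hKx, hKt⟩ := exists_compact_subset φ.open_target hx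
    let U := φ.source ∩ φ ⁻¹' interior K
    have hU : IsOpen U := φ.isOpen_inter_preimage isOpen_interior
    refine ⟨U, hU.mem_nhds ⟨mem_chart_source ℂ x, hKx⟩, ?_⟩
    have h1 : g.area U = g.chartArea φ U := by
      rw [← g.restrict_area hφ, Measure.restrict_apply hU.measurableSet,
        Set.inter_eq_left.2 (Set.inter_subset_left)]
    rw [h1, chartArea_apply g φ hU.measurableSet]
    obtain ⟨M, hM⟩ := (hK.image_of_continuousOn
      ((g.smooth φ hφ).continuousOn.mono hKt)).bddAbove
    have hsub : φ.symm ⁻¹' U ∩ φ.target ⊆ K := by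
      rintro z ⟨hz, hzt⟩
      have := hz.2
      rw [Set.mem_preimage, φ.right_inv hzt] at this
      exact interior_subset this
    refine (lintegral_mono_set hsub).trans_lt ?_
    refine (setLIntegral_mono' hK.measurableSet (g := fun _ => ENNReal.ofReal M) fun z hz =>
      ENNReal.ofReal_le_ofReal (hM ⟨z, hz, rfl⟩)).trans_lt ?_
    rw [setLIntegral_const]
    exact ENNReal.mul_lt_top ENNReal.ofReal_lt_top hK.measure_lt_top
  exact ⟨isCompact_univ.measure_lt_top⟩

instance isOpenPosMeasure_area [IsManifold 𝓘(ℂ) ω X] [CompactSpace X] :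
    g.area.IsOpenPosMeasure := by
  refine ⟨fun U hU ⟨x, hx⟩ h0 => ?_⟩
  set φ := chartAt ℂ x
  have hφ : φ ∈ atlas ℂ X := chart_mem_atlas ℂ x
  have h1 : g.chartArea φ U = 0 := by
    rw [← g.restrict_area hφ]
    exact Measure.absolutelyContinuous_of_le Measure.restrict_le_self h0
  have hm := measurableSet_symm_preimage φ hU.measurableSet
  have hae : AEMeasurable (fun z => ENNReal.ofReal (g.ρ φ z))
      (volume.restrict (φ.symm ⁻¹' U ∩ φ.target)) :=
    (((g.smooth φ hφ).continuousOn.mono Set.inter_subset_right).aemeasurable hm).ennreal_ofReal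
  rw [chartArea_apply g φ hU.measurableSet, lintegral_eq_zero_iff' hae,
    Filter.EventuallyEq, ae_restrict_iff' hm] at h1
  have hopen : IsOpen (φ.symm ⁻¹' U ∩ φ.target) := by
    rw [Set.inter_comm]; exact φ.symm.isOpen_inter_preimage hU
  have hmem : φ x ∈ φ.symm ⁻¹' U ∩ φ.target := by
    refine ⟨?_, mem_chart_target ℂ x⟩
    rw [Set.mem_preimage, φ.left_inv (mem_chart_source ℂ x)]; exact hx
  refine (hopen.measure_pos volume ⟨_, hmem⟩).ne' (measure_mono_null ?_ h1)
  intro z hz h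
  have := h hz
  simp only [Pi.zero_apply, ENNReal.ofReal_eq_zero] at this
  exact absurd (g.pos φ hφ z hz.2) this.not_gt

end ConformalMetric

end Area

/-! ### Regularity tested in coordinates -/

section Charts

/-- Quantities defined through `chartAt ℂ x` use a chart that changes with `x`; regularity has to be
read off in one fixed coordinate. -/
theorem continuous_of_comp_symm {Y : Type*} [TopologicalSpace Y] {G : X → Y}
    (h : ∀ φ ∈ atlas ℂ X, ContinuousOn (fun z => G (φ.symm z)) φ.target) : Continuous G := by
  refine continuous_iff_continuousAt.2 fun x => ?_
  have h1 := (h _ (chart_mem_atlas ℂ x)).continuousAt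
    ((chartAt ℂ x).open_target.mem_nhds (mem_chart_target ℂ x))
  have h2 := ContinuousAt.comp (f := chartAt ℂ x) h1
    ((chartAt ℂ x).continuousAt (mem_chart_source ℂ x))
  refine h2.congr ?_
  filter_upwards [(chartAt ℂ x).open_source.mem_nhds (mem_chart_source ℂ x)] with y hy
  simp [(chartAt ℂ x).left_inv hy]

theorem contMDiff_of_comp_symm [IsManifold 𝓘(ℂ) ω X] {G : X → ℝ}
    (h : ∀ φ ∈ atlas ℂ X, ContDiffOn ℝ ∞ (fun z => G (φ.symm z)) φ.target) :
    ContMDiff 𝓘(ℝ, ℂ) 𝓘(ℝ) ∞ G := by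
  have : IsManifold 𝓘(ℝ, ℂ) ∞ X := isManifold_real
  intro x
  have h1 := ((h _ (chart_mem_atlas ℂ x)).contDiffAt
    ((chartAt ℂ x).open_target.mem_nhds (mem_chart_target ℂ x))).contMDiffAt
  have h3 : ContMDiffAt 𝓘(ℝ, ℂ) 𝓘(ℝ, ℂ) ∞ (chartAt ℂ x) x :=
    contMDiffAt_of_mem_maximalAtlas (IsManifold.chart_mem_maximalAtlas x) (mem_chart_source ℂ x)
  refine (h1.comp x h3).congr_of_eventuallyEq ?_
  filter_upwards [(chartAt ℂ x).open_source.mem_nhds (mem_chart_source ℂ x)] with y hy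
  simp [(chartAt ℂ x).left_inv hy]

theorem mem_overlap_chartAt {φ : OpenPartialHomeomorph X ℂ} {z : ℂ} (hz : z ∈ φ.target) :
    z ∈ overlap φ (chartAt ℂ (φ.symm z)) :=
  ⟨hz, mem_chart_source ℂ _⟩

end Charts

/-! ### Wirtinger calculus and the Laplacian -/

section Wirtinger

theorem contDiffAt_dz {F : ℂ → ℂ} {z : ℂ} {m n : WithTop ℕ∞} (hF : ContDiffAt ℝ n F z)
    (hmn : m + 1 ≤ n) : ContDiffAt ℝ m (dz F) z ∧ ContDiffAt ℝ m (dzbar F) z := by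
  have h : ContDiffAt ℝ m (fderiv ℝ F) z := hF.fderiv_right hmn
  have h1 : ContDiffAt ℝ m (fun z => fderiv ℝ F z 1) z := h.clm_apply contDiffAt_const
  have hI : ContDiffAt ℝ m (fun z => fderiv ℝ F z Complex.I) z := h.clm_apply contDiffAt_const
  exact ⟨(h1.sub (contDiffAt_const.mul hI)).div_const 2,
    (h1.add (contDiffAt_const.mul hI)).div_const 2⟩

theorem dz_smul {F : ℂ → ℂ} {z : ℂ} (c : ℂ) (hF : DifferentiableAt ℝ F z) :
    dz (fun w => c * F w) z = c * dz F z ∧ dzbar (fun w => c * F w) z = c * dzbar F z := by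
  refine dz_eq_of_hasFDerivAt (hF.hasFDerivAt.const_mul c) fun w => ?_
  simp only [smul_apply, smul_eq_mul, fderiv_apply_eq]
  ring

theorem dz_ofReal {f : ℂ → ℝ} {z : ℂ} (hf : DifferentiableAt ℝ f z) :
    dzbar (fun w => (f w : ℂ)) z = (starRingEnd ℂ) (dz (fun w => (f w : ℂ)) z) := by
  have h : DifferentiableAt ℝ (fun w => (f w : ℂ)) z :=
    Complex.ofRealCLM.differentiableAt.comp z hf
  simpa using (dz_conj h).2

/-- In `(∂_x + i ∂_y)(∂_x - i ∂_y)` the mixed terms cancel by symmetry of the second derivative. -/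
theorem laplacian_eq_dzbar_dz {F : ℂ → ℂ} {z : ℂ} (hF : ContDiffAt ℝ 2 F z) :
    Laplacian.laplacian F z = 4 * dzbar (dz F) z := by
  have hd : DifferentiableAt ℝ (fderiv ℝ F) z :=
    (hF.fderiv_right (m := 1) (by norm_num)).differentiableAt (by norm_num)
  have happ : ∀ v, HasFDerivAt (fun w => fderiv ℝ F w v)
      ((fderiv ℝ (fderiv ℝ F) z).flip v) z := fun v => by
    simpa using hd.hasFDerivAt.clm_apply (hasFDerivAt_const v z)
  have h := (((happ 1).sub ((happ Complex.I).const_mul Complex.I)).mul_const (2⁻¹ : ℂ))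
  have hdz : dz F = fun y => ((fun w => fderiv ℝ F w 1) -
      fun y => Complex.I * fderiv ℝ F y Complex.I) y * 2⁻¹ := by
    ext w; simp [dz, div_eq_mul_inv]
  have hsymm : IsSymmSndFDerivAt ℝ F z := hF.isSymmSndFDerivAt (by simp)
  have hs := hsymm.eq 1 Complex.I
  rw [InnerProductSpace.laplacian_eq_iteratedFDeriv_complexPlane]
  simp only [iteratedFDeriv_two_apply]
  rw [dzbar, hdz, h.fderiv]
  simp [hs]
  linear_combination (fderiv ℝ (fderiv ℝ F) z Complex.I Complex.I) * Complex.I_sq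

theorem ofReal_laplacian {f : ℂ → ℝ} {z : ℂ} (hf : ContDiffAt ℝ 2 f z) :
    ((Laplacian.laplacian f z : ℝ) : ℂ) = 4 * dzbar (dz fun w => (f w : ℂ)) z := by
  have h := hf.laplacian_CLM_comp_left (l := Complex.ofRealCLM)
  have h2 : ContDiffAt ℝ 2 (fun w => (f w : ℂ)) z :=
    Complex.ofRealCLM.contDiff.contDiffAt.comp z hf
  rw [← laplacian_eq_dzbar_dz h2]
  exact h.symm

/-- `∂` of the composite is `(∂f ∘ τ) τ'`. Since `∂̄τ' = 0`, applying `∂̄` only adds the factor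
`conj τ'`. -/
theorem laplacian_comp_analytic {f : ℂ → ℝ} {τ : ℂ → ℂ} {z : ℂ} (hτ : AnalyticAt ℂ τ z)
    (hf : ContDiffAt ℝ 2 f (τ z)) :
    Laplacian.laplacian (fun w => f (τ w)) z = Laplacian.laplacian f (τ z) * ‖deriv τ z‖ ^ 2 := by
  have hτ2 : ContDiffAt ℝ 2 τ z := hτ.contDiffAt.restrict_scalars ℝ
  have hF : ContDiffAt ℝ 2 (fun w => (f w : ℂ)) (τ z) :=
    Complex.ofRealCLM.contDiff.contDiffAt.comp (τ z) hf
  have hτ' := hτ.deriv.differentiableAt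
  have hdF : DifferentiableAt ℝ (dz fun w => (f w : ℂ)) (τ z) :=
    (contDiffAt_dz (m := 1) hF (by norm_num)).1.differentiableAt (by norm_num)
  have he : (dz fun w => (f (τ w) : ℂ)) =ᶠ[nhds z]
      fun w => dz (fun w => (f w : ℂ)) (τ w) * deriv τ w := by
    have h1 := hτ.continuousAt.eventually ((hF.eventually (by simp)))
    filter_upwards [h1, hτ.eventually_analyticAt] with w hw hτw
    exact (dz_comp (F := fun w => (f w : ℂ)) (hw.differentiableAt (by norm_num))
      hτw.differentiableAt).1
  have hcomp : DifferentiableAt ℝ (fun w => dz (fun w => (f w : ℂ)) (τ w)) z :=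
    hdF.comp z hτ.differentiableAt.real_of_complex
  have hfτ : ContDiffAt ℝ 2 (fun w => f (τ w)) z := hf.comp z hτ2
  rw [← Complex.ofReal_inj, ofReal_laplacian hfτ, (dz_congr he).2,
    (dz_mul hcomp hτ'.real_of_complex).2, (dz_holomorphic hτ').2,
    (dz_comp hdF hτ.differentiableAt).2]
  push_cast
  rw [ofReal_laplacian hf, ← Complex.conj_mul']
  ring

end Wirtinger

/-! ### Norms, densities and curvature in an arbitrary coordinate -/

section Invariance

variable {p q : ℤ}

/-- The coefficient contributes `|τ'|^(2(p+q))`, which is also the factor of `ρ^(p+q)`; hence any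
coordinate may replace the preferred one. -/
theorem Tensor.normSq_symm [IsManifold 𝓘(ℂ) ω X] (κ : ℝ) (g : ConformalMetric X)
    (T : Tensor X p q) {φ : OpenPartialHomeomorph X ℂ} (hφ : φ ∈ atlas ℂ X) {z : ℂ}
    (hz : z ∈ φ.target) :
    T.normSq κ g (φ.symm z) = κ * ‖T.coeff φ z‖ ^ 2 / g.ρ φ z ^ (p + q) := by
  set ψ := chartAt ℂ (φ.symm z) with hψdef
  have hψ : ψ ∈ atlas ℂ X := chart_mem_atlas ℂ _
  have ho : z ∈ overlap φ ψ := mem_overlap_chartAt hz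
  have h0 : ‖deriv (transition φ ψ) z‖ ≠ 0 := norm_ne_zero_iff.2 (deriv_transition_ne_zero hφ hψ ho)
  have hρ := (g.pos ψ hψ _ (transition_mem ho).1).ne'
  have e : ψ (φ.symm z) = transition φ ψ z := rfl
  rw [Tensor.normSq, ← hψdef, e, T.transform φ hφ ψ hψ z ho, g.transform φ hφ ψ hψ z ho,
    mul_zpow, norm_mul, norm_mul, norm_zpow, norm_zpow, RCLike.norm_conj, ← zpow_add₀ h0,
    ← zpow_natCast, ← zpow_natCast, ← zpow_natCast, ← zpow_mul, mul_zpow, ← zpow_mul,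
    mul_comm (p + q) ((2 : ℕ) : ℤ)]
  have h2 : ‖deriv (transition φ ψ) z‖ ^ (((2 : ℕ) : ℤ) * (p + q)) ≠ 0 := zpow_ne_zero _ h0
  have h3 : g.ρ ψ (transition φ ψ z) ^ (p + q) ≠ 0 := zpow_ne_zero _ hρ
  field_simp

theorem Tensor.continuous_normSq [IsManifold 𝓘(ℂ) ω X] (κ : ℝ) (g : ConformalMetric X)
    (T : Tensor X p q) : Continuous (T.normSq κ g) := by
  refine continuous_of_comp_symm fun φ hφ => ?_
  refine ContinuousOn.congr ?_ fun z hz => T.normSq_symm κ g hφ hz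
  exact (continuousOn_const.mul ((T.smooth φ hφ).continuousOn.norm.pow 2)).div
    ((g.smooth φ hφ).continuousOn.zpow₀ _ fun z hz => Or.inl (g.pos φ hφ z hz).ne')
    fun z hz => zpow_ne_zero _ (g.pos φ hφ z hz).ne'

/-- The function `c / ρ` for which the `(1,1)`-form `c dz dz̄` is `(c / ρ) dμ`. -/
def Tensor.density (g : ConformalMetric X) (S : Tensor X 1 1) (x : X) : ℂ :=
  S.coeff (chartAt ℂ x) (chartAt ℂ x x) / (g.ρ (chartAt ℂ x) (chartAt ℂ x x) : ℂ)

theorem Tensor.density_symm [IsManifold 𝓘(ℂ) ω X] (g : ConformalMetric X) (S : Tensor X 1 1)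
    {φ : OpenPartialHomeomorph X ℂ} (hφ : φ ∈ atlas ℂ X) {z : ℂ} (hz : z ∈ φ.target) :
    S.density g (φ.symm z) = S.coeff φ z / (g.ρ φ z : ℂ) := by
  set ψ := chartAt ℂ (φ.symm z) with hψdef
  have hψ : ψ ∈ atlas ℂ X := chart_mem_atlas ℂ _
  have ho : z ∈ overlap φ ψ := mem_overlap_chartAt hz
  have h0 := deriv_transition_ne_zero hφ hψ ho
  have h1 : (starRingEnd ℂ) (deriv (transition φ ψ) z) ≠ 0 := by simpa using h0
  have hρ : (g.ρ ψ (transition φ ψ z) : ℂ) ≠ 0 :=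
    Complex.ofReal_ne_zero.2 (g.pos ψ hψ _ (transition_mem ho).1).ne'
  have e : ψ (φ.symm z) = transition φ ψ z := rfl
  rw [Tensor.density, ← hψdef, e, S.transform φ hφ ψ hψ z ho, g.transform_ofReal hφ hψ ho]
  simp only [zpow_one]
  field_simp

theorem Tensor.continuous_density [IsManifold 𝓘(ℂ) ω X] (g : ConformalMetric X)
    (S : Tensor X 1 1) : Continuous (S.density g) := by
  refine continuous_of_comp_symm fun φ hφ => ?_
  refine ContinuousOn.congr ?_ fun z hz => S.density_symm g hφ hz
  exact (S.smooth φ hφ).continuousOn.div (g.smooth_ofReal hφ).continuousOn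
    fun z hz => Complex.ofReal_ne_zero.2 (g.pos φ hφ z hz).ne'

namespace ConformalMetric

variable (g : ConformalMetric X)

theorem contDiffOn_log {φ : OpenPartialHomeomorph X ℂ} (hφ : φ ∈ atlas ℂ X) :
    ContDiffOn ℝ ∞ (fun w => Real.log (g.ρ φ w)) φ.target :=
  (g.smooth φ hφ).log fun z hz => (g.pos φ hφ z hz).ne'

theorem contDiffAt_log {φ : OpenPartialHomeomorph X ℂ} (hφ : φ ∈ atlas ℂ X) {z : ℂ}
    (hz : z ∈ φ.target) : ContDiffAt ℝ 2 (fun w => Real.log (g.ρ φ w)) z :=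
  ((g.contDiffOn_log hφ).contDiffAt (φ.open_target.mem_nhds hz)).of_le ENat.LEInfty.out

/-- `log ρ` changes by `2 log |τ'|`, which is harmonic because `τ'` is holomorphic without zeros;
the Laplacian and `ρ` then scale by the same `|τ'|²`. -/
theorem curvature_symm [IsManifold 𝓘(ℂ) ω X] {φ : OpenPartialHomeomorph X ℂ}
    (hφ : φ ∈ atlas ℂ X) {z : ℂ} (hz : z ∈ φ.target) :
    g.curvature (φ.symm z) =
      -Laplacian.laplacian (fun w => Real.log (g.ρ φ w)) z / (2 * g.ρ φ z) := by
  set ψ := chartAt ℂ (φ.symm z) with hψdef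
  have hψ : ψ ∈ atlas ℂ X := chart_mem_atlas ℂ _
  have ho : z ∈ overlap φ ψ := mem_overlap_chartAt hz
  have hτ := analyticAt_transition hφ hψ ho
  have h0 := deriv_transition_ne_zero hφ hψ ho
  have hm := (transition_mem ho).1
  have hρ := (g.pos ψ hψ _ hm).ne'
  have hharm := hτ.deriv.harmonicAt_log_norm h0
  have e : ψ (φ.symm z) = transition φ ψ z := rfl
  have he : (fun w => Real.log (g.ρ φ w)) =ᶠ[nhds z]
      (fun w => Real.log (g.ρ ψ (transition φ ψ w))) +
        (2 : ℝ) • fun w => Real.log ‖deriv (transition φ ψ) w‖ := by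
    filter_upwards [(isOpen_overlap φ ψ).mem_nhds ho] with w hw
    have h0w : ‖deriv (transition φ ψ) w‖ ≠ 0 :=
      norm_ne_zero_iff.2 (deriv_transition_ne_zero hφ hψ hw)
    rw [g.transform φ hφ ψ hψ w hw,
      Real.log_mul (g.pos ψ hψ _ (transition_mem hw).1).ne' (pow_ne_zero 2 h0w), Real.log_pow]
    simp
  have hl := g.contDiffAt_log hψ hm
  have hlc : ContDiffAt ℝ 2 (fun w => Real.log (g.ρ ψ (transition φ ψ w))) z :=
    hl.comp z (hτ.contDiffAt.restrict_scalars ℝ)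
  have hz0 : Laplacian.laplacian (fun w => Real.log ‖deriv (transition φ ψ) w‖) z = 0 :=
    hharm.2.eq_of_nhds
  have hsm : ContDiffAt ℝ 2 ((2 : ℝ) • fun w => Real.log ‖deriv (transition φ ψ) w‖) z :=
    contDiffAt_const.smul hharm.1
  rw [curvature, ← hψdef, e, InnerProductSpace.laplacian_congr_nhds he |>.eq_of_nhds,
    hlc.laplacian_add hsm, InnerProductSpace.laplacian_smul _ hharm.1,
    hz0, laplacian_comp_analytic hτ hl, g.transform φ hφ ψ hψ z ho]
  have h0n : ‖deriv (transition φ ψ) z‖ ≠ 0 := norm_ne_zero_iff.2 h0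
  simp only [smul_zero, add_zero]
  field_simp

theorem contDiffOn_curvature_symm [IsManifold 𝓘(ℂ) ω X] {φ : OpenPartialHomeomorph X ℂ}
    (hφ : φ ∈ atlas ℂ X) : ContDiffOn ℝ ∞ (fun z => g.curvature (φ.symm z)) φ.target := by
  have hlog : ContDiffOn ℝ ∞ (fun w => (Real.log (g.ρ φ w) : ℂ)) φ.target :=
    Complex.ofRealCLM.contDiff.comp_contDiffOn (g.contDiffOn_log hφ)
  have h2 := (contDiffOn_dz φ.open_target (contDiffOn_dz φ.open_target hlog).1).2
  have h3 : ContDiffOn ℝ ∞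
      (fun z => (4 * dzbar (dz fun w => (Real.log (g.ρ φ w) : ℂ)) z).re) φ.target :=
    Complex.reCLM.contDiff.comp_contDiffOn (contDiffOn_const.mul h2)
  refine (h3.neg.div (contDiffOn_const.mul (g.smooth φ hφ))
    fun z hz => mul_ne_zero two_ne_zero (g.pos φ hφ z hz).ne').congr fun z hz => ?_
  simp only [Pi.div_apply]
  rw [g.curvature_symm hφ hz, ← ofReal_laplacian (g.contDiffAt_log hφ hz), Complex.ofReal_re]

theorem continuous_curvature [IsManifold 𝓘(ℂ) ω X] : Continuous g.curvature :=
  continuous_of_comp_symm fun _ hφ => (g.contDiffOn_curvature_symm hφ).continuousOn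

end ConformalMetric

end Invariance

/-! ### Stokes' theorem for `∂̄` of a `(1,0)`-form -/

section Stokes

open MeasureTheory

theorem dz_sum {ι : Type*} {s : Finset ι} {F : ι → ℂ → ℂ} {z : ℂ}
    (hF : ∀ i ∈ s, DifferentiableAt ℝ (F i) z) :
    dz (fun w => ∑ i ∈ s, F i w) z = ∑ i ∈ s, dz (F i) z ∧
      dzbar (fun w => ∑ i ∈ s, F i w) z = ∑ i ∈ s, dzbar (F i) z := by
  refine dz_eq_of_hasFDerivAt (HasFDerivAt.fun_sum fun i hi => (hF i hi).hasFDerivAt) fun w => ?_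
  simp only [sum_apply, fderiv_apply_eq, Finset.sum_add_distrib, Finset.sum_mul]

theorem integral_fderiv_eq_zero {G : ℂ → ℂ} (hG : ContDiff ℝ 1 G) (hc : HasCompactSupport G)
    (v : ℂ) : ∫ z, fderiv ℝ G z v = 0 := by
  have hcont : Continuous fun z => fderiv ℝ G z v :=
    (hG.continuous_fderiv (by norm_num)).clm_apply continuous_const
  have hint : Integrable fun z => fderiv ℝ G z v :=
    hcont.integrable_of_hasCompactSupport (hc.fderiv_apply ℝ v)
  -- Integration by parts against the constant `1`, whose derivative vanishes.
  have h := integral_mul_fderiv_eq_neg_fderiv_mul_of_integrable (𝕜 := ℂ) (μ := volume)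
    (f := fun _ : ℂ => (1 : ℂ)) (g := G) (v := v) (by simp) (by simpa using hint)
    (by simpa using hG.continuous.integrable_of_hasCompactSupport hc)
    (fun _ _ => differentiableAt_const _)
    (fun _ _ => hG.differentiable (by norm_num) _)
  simpa using h

theorem integral_dzbar_eq_zero {G : ℂ → ℂ} (hG : ContDiff ℝ 1 G) (hc : HasCompactSupport G) :
    ∫ z, dzbar G z = 0 := by
  have hint : ∀ v : ℂ, Integrable fun z => fderiv ℝ G z v := fun v =>
    ((hG.continuous_fderiv (by norm_num)).clm_apply
      continuous_const).integrable_of_hasCompactSupport (hc.fderiv_apply ℝ v)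
  simp only [dzbar]
  rw [integral_div, integral_add (hint 1) ((hint _).const_mul _), integral_const_mul,
    integral_fderiv_eq_zero hG hc, integral_fderiv_eq_zero hG hc]
  simp

variable [IsManifold 𝓘(ℂ) ω X] {p q : ℤ}

/-- The product of a tensor field with a smooth real function. -/
def Tensor.smulFun (v : C^∞⟮𝓘(ℝ, ℂ), X; ℝ⟯) (T : Tensor X p q) : Tensor X p q where
  coeff φ z := (v (φ.symm z) : ℂ) * T.coeff φ z
  smooth φ hφ :=
    (Complex.ofRealCLM.contDiff.comp_contDiffOn (contDiffOn_comp_symm v hφ)).mul (T.smooth φ hφ)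
  transform φ hφ ψ hψ z hz := by
    rw [T.transform φ hφ ψ hψ z hz, transition, ψ.left_inv hz.2]; ring

theorem Tensor.density_dbar_smulFun_of_notMem (g : ConformalMetric X) (v : C^∞⟮𝓘(ℝ, ℂ), X; ℝ⟯)
    (T : OneForm X) {x : X} (hx : x ∉ tsupport v) : (T.smulFun v).dbar.density g x = 0 := by
  have hev := notMem_tsupport_iff_eventuallyEq.1 hx
  have hcont := (chartAt ℂ x).continuousAt_symm (mem_chart_target ℂ x)
  rw [ContinuousAt, (chartAt ℂ x).left_inv (mem_chart_source ℂ x)] at hcont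
  have h : (T.smulFun v).coeff (chartAt ℂ x) =ᶠ[nhds (chartAt ℂ x x)] fun _ => 0 := by
    filter_upwards [hcont.eventually hev] with z hz
    simp [Tensor.smulFun, hz]
  have h2 : (T.smulFun v).dbar.coeff (chartAt ℂ x) (chartAt ℂ x x) = 0 := by
    change dzbar ((T.smulFun v).coeff (chartAt ℂ x)) (chartAt ℂ x x) = 0
    rw [(dz_congr h).2]
    simp [dzbar]
  rw [Tensor.density, h2, zero_div]

variable [CompactSpace X] [MeasurableSpace X] [BorelSpace X]

/-- The case of support in one chart: the factor `ρ` of the area cancels the denominator of the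
density, leaving the integral over `ℂ` of `∂̄` of a compactly supported function. -/
theorem Tensor.integral_density_dbar_smulFun (g : ConformalMetric X)
    (v : C^∞⟮𝓘(ℝ, ℂ), X; ℝ⟯) (T : OneForm X) {φ : OpenPartialHomeomorph X ℂ}
    (hφ : φ ∈ atlas ℂ X) (hv : tsupport v ⊆ φ.source) :
    ∫ x, (T.smulFun v).dbar.density g x ∂g.area = 0 := by
  rw [← setIntegral_eq_integral_of_forall_compl_eq_zero (s := φ.source)
    fun x hx => T.density_dbar_smulFun_of_notMem g v fun h => hx (hv h),
    g.integral_source hφ (Tensor.continuous_density g _)]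
  set K := φ '' tsupport v with hK
  have hKc : IsCompact K :=
    (isClosed_tsupport v).isCompact.image_of_continuousOn (φ.continuousOn.mono hv)
  have hKt : K ⊆ φ.target := by
    rintro _ ⟨x, hx, rfl⟩
    exact φ.map_source (hv hx)
  -- The coefficient has meaningless values outside `φ.target`, so it is cut off there. The cut is
  -- smooth because the support lies in the compact set `K` inside `φ.target`.
  set G : ℂ → ℂ := φ.target.indicator ((T.smulFun v).coeff φ) with hGdef
  have hG0 : ∀ z, z ∉ K → G z = 0 := by
    intro z hz
    by_cases hzt : z ∈ φ.target
    · rw [hGdef, Set.indicator_of_mem hzt]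
      have : v (φ.symm z) = 0 := by
        refine image_eq_zero_of_notMem_tsupport fun h => hz ⟨_, h, φ.right_inv hzt⟩
      simp [Tensor.smulFun, this]
    · exact Set.indicator_of_notMem hzt _
  have hGK : ∀ z, z ∉ K → G =ᶠ[nhds z] fun _ => 0 := fun z hz => by
    filter_upwards [hKc.isClosed.isOpen_compl.mem_nhds hz] with w hw using hG0 w hw
  have hGt : ∀ z ∈ φ.target, G =ᶠ[nhds z] (T.smulFun v).coeff φ := fun z hz => by
    filter_upwards [φ.open_target.mem_nhds hz] with w hw using Set.indicator_of_mem hw _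
  have hGs : ContDiff ℝ 1 G := by
    refine contDiff_iff_contDiffAt.2 fun z => ?_
    by_cases hz : z ∈ φ.target
    · exact ((((T.smulFun v).smooth φ hφ).contDiffAt (φ.open_target.mem_nhds hz)).of_le
        ENat.LEInfty.out).congr_of_eventuallyEq (hGt z hz)
    · exact contDiffAt_const.congr_of_eventuallyEq (hGK z fun h => hz (hKt h))
  have hGc : HasCompactSupport G := HasCompactSupport.intro hKc hG0
  rw [← integral_dzbar_eq_zero hGs hGc, ← setIntegral_eq_integral_of_forall_compl_eq_zero
    (s := φ.target) (f := dzbar G)]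
  · refine setIntegral_congr_fun φ.open_target.measurableSet fun z hz => ?_
    have hρ := Complex.ofReal_ne_zero.2 (g.pos φ hφ z hz).ne'
    rw [Tensor.density_symm g _ hφ hz, (dz_congr (hGt z hz)).2, mul_div_cancel₀ _ hρ]
    rfl
  · intro z hz
    rw [(dz_congr (hGK z fun h => hz (hKt h))).2]
    simp [dzbar]

/-- A partition of unity subordinate to finitely many charts writes `T` as a sum of forms `χᵢ T`,
each covered by the single-chart case. -/
theorem Tensor.integral_density_dbar [T2Space X] (g : ConformalMetric X) (T : OneForm X) :
    ∫ x, T.dbar.density g x ∂g.area = 0 := by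
  have : IsManifold 𝓘(ℝ, ℂ) ∞ X := isManifold_real
  obtain ⟨t, ht⟩ := isCompact_univ.elim_finite_subcover (fun x : X => (chartAt ℂ x).source)
    (fun x => (chartAt ℂ x).open_source) fun x _ => Set.mem_iUnion.2 ⟨x, mem_chart_source ℂ x⟩
  obtain ⟨χ, hχ⟩ := SmoothPartitionOfUnity.exists_isSubordinate 𝓘(ℝ, ℂ) (isClosed_univ (X := X))
    (fun i : t => (chartAt ℂ (i : X)).source) (fun i => (chartAt ℂ (i : X)).open_source)
    (by simpa [Set.iUnion_subtype] using ht)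
  have hsum : ∀ x, ∑ i, (χ i x : ℂ) = 1 := by
    intro x
    have := χ.sum_eq_one (Set.mem_univ x)
    rw [finsum_eq_sum_of_fintype] at this
    exact_mod_cast this
  have hpt : ∀ x, T.dbar.density g x = ∑ i, (T.smulFun (χ i)).dbar.density g x := by
    intro x
    have hx := mem_chart_target ℂ x
    have hφ := chart_mem_atlas ℂ x
    have h1 : T.coeff (chartAt ℂ x) = fun w => ∑ i, (T.smulFun (χ i)).coeff (chartAt ℂ x) w := by
      ext w
      simp only [Tensor.smulFun]
      rw [← Finset.sum_mul, hsum, one_mul]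
    have h2 : T.dbar.coeff (chartAt ℂ x) (chartAt ℂ x x) =
        ∑ i, (T.smulFun (χ i)).dbar.coeff (chartAt ℂ x) (chartAt ℂ x x) := by
      change dzbar (T.coeff (chartAt ℂ x)) _ = _
      rw [h1, (dz_sum fun i _ => (T.smulFun (χ i)).differentiableAt hφ hx).2]
      rfl
    simp only [Tensor.density]
    rw [h2, Finset.sum_div]
  simp only [hpt]
  rw [integral_finsetSum]
  · exact Finset.sum_eq_zero fun i _ =>
      T.integral_density_dbar_smulFun g (χ i) (chart_mem_atlas ℂ _) (hχ i)
  · exact fun i _ => (Tensor.continuous_density g _).integrable_of_hasCompactSupport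
      (HasCompactSupport.of_compactSpace _)

end Stokes

/-! ### Differentiating the functional under the integral sign -/

section Variation

open MeasureTheory

/-- Joint continuity bounds `F'` on the compact set `[t₀ - 1, t₀ + 1] × Y`, and a constant is an
integrable dominating function for a finite measure. -/
theorem hasDerivAt_integral_of_continuous {Y : Type*} [TopologicalSpace Y] [CompactSpace Y]
    [MeasurableSpace Y] [BorelSpace Y] (μ : Measure Y) [IsFiniteMeasure μ] {F F' : ℝ → Y → ℝ}
    (hF : ∀ t, Continuous (F t)) (hF' : Continuous fun r : ℝ × Y => F' r.1 r.2)
    (h : ∀ t y, HasDerivAt (fun s => F s y) (F' t y) t) (t₀ : ℝ) :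
    HasDerivAt (fun t => ∫ y, F t y ∂μ) (∫ y, F' t₀ y ∂μ) t₀ := by
  obtain ⟨M, hM⟩ := (((isCompact_closedBall t₀ 1).prod (isCompact_univ (X := Y))).image
    hF'.norm).bddAbove
  refine (hasDerivAt_integral_of_dominated_loc_of_deriv_le (bound := fun _ => M)
    (Metric.closedBall_mem_nhds t₀ one_pos)
    (Filter.Eventually.of_forall fun t => (hF t).aestronglyMeasurable)
    ((hF t₀).integrable_of_hasCompactSupport (HasCompactSupport.of_compactSpace _))
    (hF'.comp (Continuous.prodMk_right t₀)).aestronglyMeasurable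
    (Filter.Eventually.of_forall fun y t ht => hM ⟨(t, y), ⟨ht, Set.mem_univ y⟩, rfl⟩)
    (integrable_const M) (Filter.Eventually.of_forall fun y t _ => h t y)).2

theorem eq_zero_of_integral_eq_zero {Y : Type*} [TopologicalSpace Y] [CompactSpace Y]
    [MeasurableSpace Y] [BorelSpace Y] (μ : Measure Y) [IsFiniteMeasure μ] [μ.IsOpenPosMeasure]
    {G : Y → ℝ} (hG : Continuous G) (h0 : ∀ y, 0 ≤ G y) (h : ∫ y, G y ∂μ = 0) (y : Y) :
    G y = 0 := by
  have h1 := (integral_eq_zero_iff_of_nonneg h0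
    (hG.integrable_of_hasCompactSupport (HasCompactSupport.of_compactSpace _))).1 h
  exact congrFun ((Continuous.ae_eq_iff_eq μ hG continuous_const).1 h1) y

theorem differentiableAt_complex_of_dzbar_eq_zero {F : ℂ → ℂ} {z : ℂ}
    (hF : DifferentiableAt ℝ F z) (h : dzbar F z = 0) : DifferentiableAt ℂ F z := by
  refine differentiableAt_complex_iff_differentiableAt_real.2 ⟨hF, ?_⟩
  rw [fderiv_apply_eq, fderiv_apply_eq, h]
  simp [mul_comm]

namespace Tensor

variable {p q : ℤ}

theorem ext_coeff {S T : Tensor X p q} (h : ∀ φ z, S.coeff φ z = T.coeff φ z) : S = T := by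
  cases S; cases T
  simp only [Tensor.mk.injEq]
  funext φ z
  exact h φ z

instance : Zero (Tensor X p q) where
  zero :=
    { coeff := fun _ _ => 0
      smooth := fun _ _ => contDiffOn_const
      transform := fun _ _ _ _ _ _ => by simp }

/-- Lets variations in `u` alone be read as the joint variation with `w = 0`. -/
theorem add_smul_zero (S : Tensor X p q) (t : ℝ) : S + t • (0 : Tensor X p q) = S :=
  ext_coeff fun φ z => by
    change S.coeff φ z + (t : ℂ) * 0 = _
    simp

/-- The real inner product of two sections, the polarization of `normSq`. -/
def innerAt (κ : ℝ) (g : ConformalMetric X) (S T : Tensor X p q) (x : X) : ℝ :=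
  κ * (S.coeff (chartAt ℂ x) (chartAt ℂ x x) *
    (starRingEnd ℂ) (T.coeff (chartAt ℂ x) (chartAt ℂ x x))).re /
      g.ρ (chartAt ℂ x) (chartAt ℂ x x) ^ (p + q)

theorem normSq_add_smul (κ : ℝ) (g : ConformalMetric X) (S T : Tensor X p q) (t : ℝ) (x : X) :
    (S + t • T).normSq κ g x =
      S.normSq κ g x + 2 * t * S.innerAt κ g T x + t ^ 2 * T.normSq κ g x := by
  have h : (S + t • T).coeff (chartAt ℂ x) (chartAt ℂ x x) =
      S.coeff (chartAt ℂ x) (chartAt ℂ x x) + t * T.coeff (chartAt ℂ x) (chartAt ℂ x x) := rfl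
  simp only [normSq, innerAt, h, ← Complex.normSq_eq_norm_sq, Complex.normSq_add,
    Complex.normSq_ofReal, map_mul, Complex.conj_ofReal]
  rw [mul_left_comm, Complex.re_ofReal_mul]
  ring

theorem continuous_innerAt [IsManifold 𝓘(ℂ) ω X] (κ : ℝ) (g : ConformalMetric X)
    (S T : Tensor X p q) : Continuous (S.innerAt κ g T) := by
  have h : S.innerAt κ g T = fun x =>
      ((S + (1 : ℝ) • T).normSq κ g x - S.normSq κ g x - T.normSq κ g x) / 2 := by
    funext x
    rw [normSq_add_smul]
    ring
  rw [h]
  exact (((continuous_normSq κ g _).sub (continuous_normSq κ g _)).sub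
    (continuous_normSq κ g _)).div_const 2

/-- The contraction of a section of `K² ⊗ K̄^q` with a vector field. -/
def contract [IsManifold 𝓘(ℂ) ω X] (S : Tensor X 2 q) (w : VectorField X) : Tensor X 1 q where
  coeff φ z := S.coeff φ z * w.coeff φ z
  smooth φ hφ := (S.smooth φ hφ).mul (w.smooth φ hφ)
  transform φ hφ ψ hψ z hz := by
    have h0 := deriv_transition_ne_zero hφ hψ hz
    rw [S.transform φ hφ ψ hψ z hz, w.transform φ hφ ψ hψ z hz]
    simp only [zpow_neg, zpow_ofNat]
    field_simp

/-- The vector field `c̄ ρ⁻² ∂/∂z` metrically dual to `c dz² dz̄`. -/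
def sharp [IsManifold 𝓘(ℂ) ω X] (g : ConformalMetric X) (S : Tensor X 2 1) : VectorField X where
  coeff φ z := (starRingEnd ℂ) (S.coeff φ z) * ((g.ρ φ z : ℂ) ^ 2)⁻¹
  smooth φ hφ := ((Complex.conjCLE : ℂ →L[ℝ] ℂ).contDiff.comp_contDiffOn (S.smooth φ hφ)).mul
    (((g.smooth_ofReal hφ).pow 2).inv fun z hz =>
      pow_ne_zero 2 (Complex.ofReal_ne_zero.2 (g.pos φ hφ z hz).ne'))
  transform φ hφ ψ hψ z hz := by
    have h0 := deriv_transition_ne_zero hφ hψ hz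
    have h1 : (starRingEnd ℂ) (deriv (transition φ ψ) z) ≠ 0 := by simpa using h0
    have hρ : (g.ρ ψ (transition φ ψ z) : ℂ) ≠ 0 :=
      Complex.ofReal_ne_zero.2 (g.pos ψ hψ _ (transition_mem hz).1).ne'
    rw [S.transform φ hφ ψ hψ z hz, g.transform_ofReal hφ hψ hz]
    simp only [map_mul, zpow_neg, zpow_ofNat]
    field_simp
    simp only [map_pow, Complex.conj_conj]
    ring

/-- This makes `sharp` the test direction: for `S = ∂̄α` the variation becomes a multiple of an
integral of `|∂̄α|²`. -/
theorem density_contract_sharp [IsManifold 𝓘(ℂ) ω X] (g : ConformalMetric X) (S : Tensor X 2 1)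
    (x : X) : (S.contract (S.sharp g)).density g x = (S.normSq 1 g x : ℂ) := by
  have hρ := (g.pos _ (chart_mem_atlas ℂ x) _ (mem_chart_target ℂ x)).ne'
  have hρ' := Complex.ofReal_ne_zero.2 hρ
  have h3 : (2 : ℤ) + 1 = ((3 : ℕ) : ℤ) := by norm_num
  simp only [density, contract, sharp, normSq, h3, zpow_natCast]
  rw [← mul_assoc, Complex.mul_conj']
  push_cast
  field_simp

theorem isHolomorphic_iff [IsManifold 𝓘(ℂ) ω X] (T : Tensor X p 0) :
    T.IsHolomorphic ↔ ∀ φ ∈ atlas ℂ X, ∀ z ∈ φ.target, dzbar (T.coeff φ) z = 0 := by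
  constructor
  · intro h φ hφ z hz
    exact (dz_holomorphic ((h φ hφ).differentiableAt (φ.open_target.mem_nhds hz))).2
  · intro h φ hφ z hz
    exact (differentiableAt_complex_of_dzbar_eq_zero (T.differentiableAt hφ hz)
      (h φ hφ z hz)).differentiableWithinAt

end Tensor

variable [IsManifold 𝓘(ℂ) ω X]

theorem differentiableAt_comp_symm (u : C^∞⟮𝓘(ℝ, ℂ), X; ℝ⟯) {φ : OpenPartialHomeomorph X ℂ}
    (hφ : φ ∈ atlas ℂ X) {z : ℂ} (hz : z ∈ φ.target) :
    DifferentiableAt ℝ (fun w => u (φ.symm w)) z :=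
  ((contDiffOn_comp_symm u hφ).contDiffAt (φ.open_target.mem_nhds hz)).differentiableAt (by simp)

theorem differentiableAt_ofReal_comp_symm (u : C^∞⟮𝓘(ℝ, ℂ), X; ℝ⟯)
    {φ : OpenPartialHomeomorph X ℂ} (hφ : φ ∈ atlas ℂ X) {z : ℂ} (hz : z ∈ φ.target) :
    DifferentiableAt ℝ (fun w => (u (φ.symm w) : ℂ)) z :=
  Complex.ofRealCLM.differentiableAt.comp z (differentiableAt_comp_symm u hφ hz)

theorem del_add_smul_coeff (u v : C^∞⟮𝓘(ℝ, ℂ), X; ℝ⟯) (t : ℝ) {φ : OpenPartialHomeomorph X ℂ}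
    (hφ : φ ∈ atlas ℂ X) {z : ℂ} (hz : z ∈ φ.target) :
    (del (u + t • v)).coeff φ z = (del u + t • del v).coeff φ z := by
  have hu := differentiableAt_ofReal_comp_symm u hφ hz
  have hv := differentiableAt_ofReal_comp_symm v hφ hz
  change dz (fun w => ((u + t • v) (φ.symm w) : ℂ)) z =
    dz (fun w => (u (φ.symm w) : ℂ)) z + t * dz (fun w => (v (φ.symm w) : ℂ)) z
  rw [← (dz_smul (t : ℂ) hv).1, ← (dz_add hu (hv.const_mul _)).1]
  simp

theorem normSq_del_add_smul (g : ConformalMetric X) (u v : C^∞⟮𝓘(ℝ, ℂ), X; ℝ⟯) (t : ℝ) (x : X) :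
    (del (u + t • v)).normSq 2 g x = (del u).normSq 2 g x +
      2 * t * (del u).innerAt 2 g (del v) x + t ^ 2 * (del v).normSq 2 g x := by
  rw [← Tensor.normSq_add_smul, Tensor.normSq, Tensor.normSq,
    del_add_smul_coeff u v t (chart_mem_atlas ℂ x) (mem_chart_target ℂ x)]

theorem normSq_dbar_add_smul (κ : ℝ) (g : ConformalMetric X) (β : BeltramiForm X)
    (f w : VectorField X) (t : ℝ) (x : X) :
    (β + (f + t • w).dbar).normSq κ g x = (β + f.dbar).normSq κ g x +
      2 * t * (β + f.dbar).innerAt κ g w.dbar x + t ^ 2 * w.dbar.normSq κ g x := by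
  have hφ := chart_mem_atlas ℂ x
  have hx := mem_chart_target ℂ x
  have hf := f.differentiableAt hφ hx
  have hw := w.differentiableAt hφ hx
  have h : (β + (f + t • w).dbar).coeff (chartAt ℂ x) (chartAt ℂ x x) =
      (β + f.dbar + t • w.dbar).coeff (chartAt ℂ x) (chartAt ℂ x x) := by
    change β.coeff _ _ + dzbar (fun y => f.coeff (chartAt ℂ x) y + t * w.coeff (chartAt ℂ x) y) _ =
      β.coeff _ _ + dzbar (f.coeff (chartAt ℂ x)) _ + t * dzbar (w.coeff (chartAt ℂ x)) _
    rw [(dz_add hf (hw.const_mul _)).2, (dz_smul (t : ℂ) hw).2, add_assoc]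
  rw [← Tensor.normSq_add_smul, Tensor.normSq, Tensor.normSq, h]

theorem continuous_integrand (κ lam : ℝ) (g : ConformalMetric X) (β : BeltramiForm X)
    (u : C^∞⟮𝓘(ℝ, ℂ), X; ℝ⟯) (f : VectorField X) : Continuous (integrand κ lam g β u f) := by
  have hu : Continuous u := u.contMDiff.continuous
  have h1 := (del u).continuous_normSq 2 g
  have h2 := (β + f.dbar).continuous_normSq κ g
  have h3 := g.continuous_curvature
  unfold integrand
  fun_prop

/-- The derivative of the integrand of the functional in the direction `(v, w)`. -/
def integrandDeriv (κ lam : ℝ) (g : ConformalMetric X) (β : BeltramiForm X)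
    (u v : C^∞⟮𝓘(ℝ, ℂ), X; ℝ⟯) (f w : VectorField X) (x : X) : ℝ :=
  2 * (del u).innerAt 2 g (del v) x + g.curvature x * v x +
    Real.exp (2 * u x) * (2 * v x * (-lam / 2 + (β + f.dbar).normSq κ g x) +
      2 * (β + f.dbar).innerAt κ g w.dbar x)

theorem hasDerivAt_donaldson [CompactSpace X] [MeasurableSpace X] [BorelSpace X]
    (κ lam C : ℝ) (g : ConformalMetric X) (β : BeltramiForm X)
    (u v : C^∞⟮𝓘(ℝ, ℂ), X; ℝ⟯) (f w : VectorField X) :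
    HasDerivAt (fun t : ℝ => donaldson κ lam C g β (u + t • v) (f + t • w))
      (∫ x, integrandDeriv κ lam g β u v f w x ∂g.area) 0 := by
  have hu : Continuous u := u.contMDiff.continuous
  have hv : Continuous v := v.contMDiff.continuous
  have hB0 := (β + f.dbar).continuous_normSq κ g
  have hA1 := (del u).continuous_innerAt 2 g (del v)
  have hB1 := (β + f.dbar).continuous_innerAt κ g w.dbar
  have hA2 := (del v).continuous_normSq 2 g
  have hB2 := w.dbar.continuous_normSq κ g
  have hK := g.continuous_curvature
  have key := hasDerivAt_integral_of_continuous g.area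
    (F := fun t => integrand κ lam g β (u + t • v) (f + t • w))
    -- Both squared norms are exact quadratic polynomials in `t`, so the derivative is explicit at
    -- every `t`, as domination near `0` requires.
    (F' := fun t x => 2 * (del u).innerAt 2 g (del v) x + 2 * t * (del v).normSq 2 g x +
      g.curvature x * v x +
      (Real.exp (2 * (u x + t * v x)) * (2 * v x) * (-lam / 2 + ((β + f.dbar).normSq κ g x +
        2 * t * (β + f.dbar).innerAt κ g w.dbar x + t ^ 2 * w.dbar.normSq κ g x)) +
      Real.exp (2 * (u x + t * v x)) * (2 * (β + f.dbar).innerAt κ g w.dbar x +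
        2 * t * w.dbar.normSq κ g x)))
    (fun t => continuous_integrand κ lam g β _ _) (by fun_prop) ?_ 0
  · have := key.add_const C
    simp only [mul_zero, zero_mul, add_zero, zero_pow two_ne_zero] at this
    refine this.congr_deriv (integral_congr_ae (Filter.Eventually.of_forall fun x => ?_))
    simp only [integrandDeriv]
    ring
  · intro t x
    have hpow : ∀ a b c : ℝ, HasDerivAt (fun s : ℝ => a + 2 * s * b + s ^ 2 * c)
        (2 * b + 2 * t * c) t := fun a b c => by
      have h := (((((hasDerivAt_id t).const_mul 2).mul_const b).const_add a).add
        (((hasDerivAt_id t).pow 2).mul_const c))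
      refine h.congr_deriv ?_
      simp
    have hlin : HasDerivAt (fun s : ℝ => u x + s * v x) (v x) t := by
      simpa using ((hasDerivAt_id t).mul_const (v x)).const_add (u x)
    have h := ((hpow ((del u).normSq 2 g x) ((del u).innerAt 2 g (del v) x)
      ((del v).normSq 2 g x)).add (hlin.const_mul (g.curvature x))).add
      ((hlin.const_mul 2).exp.mul ((hpow ((β + f.dbar).normSq κ g x)
        ((β + f.dbar).innerAt κ g w.dbar x) (w.dbar.normSq κ g x)).const_add (-lam / 2)))
    refine (h.congr_of_eventuallyEq (Filter.Eventually.of_forall fun s => ?_)).congr_deriv ?_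
    · simp only [integrand, normSq_del_add_smul, normSq_dbar_add_smul]
      simp
    · ring

end Variation

/-! ### The first variation formula and the Euler–Lagrange equations -/

section EulerLagrange

open MeasureTheory

variable [IsManifold 𝓘(ℂ) ω X]

/-- In `∂(ρ f̄ dz)` the derivative falling on `ρ` is removed by the Christoffel term, which leaves
`ρ` times the conjugate of `∂̄f`. -/
theorem hopf_coeff (g : ConformalMetric X) (β : BeltramiForm X) (u : C^∞⟮𝓘(ℝ, ℂ), X; ℝ⟯)
    (f : VectorField X) {φ : OpenPartialHomeomorph X ℂ} (hφ : φ ∈ atlas ℂ X) {z : ℂ}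
    (hz : z ∈ φ.target) :
    (hopf g β u f).coeff φ z = (Real.exp (2 * u (φ.symm z)) : ℂ) *
      ((g.ρ φ z : ℂ) * (starRingEnd ℂ) ((β + f.dbar).coeff φ z)) := by
  have hρ := Complex.ofReal_ne_zero.2 (g.pos φ hφ z hz).ne'
  have hf := f.differentiableAt hφ hz
  have hdρ : DifferentiableAt ℝ (fun w => (g.ρ φ w : ℂ)) z :=
    ((g.smooth_ofReal hφ).contDiffAt (φ.open_target.mem_nhds hz)).differentiableAt (by simp)
  have hcf : DifferentiableAt ℝ (fun w => (starRingEnd ℂ) (f.coeff φ w)) z :=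
    (Complex.conjCLE : ℂ →L[ℝ] ℂ).differentiableAt.comp z hf
  change (Real.exp (2 * u (φ.symm z)) : ℂ) * ((g.ρ φ z : ℂ) * (starRingEnd ℂ) (β.coeff φ z) +
    (dz (fun w => (g.ρ φ w : ℂ) * (starRingEnd ℂ) (f.coeff φ w)) z -
      (g.ρ φ z : ℂ) * (starRingEnd ℂ) (f.coeff φ z) *
        (dz (fun w => (g.ρ φ w : ℂ)) z / (g.ρ φ z : ℂ)))) =
    (Real.exp (2 * u (φ.symm z)) : ℂ) * ((g.ρ φ z : ℂ) *
      (starRingEnd ℂ) (β.coeff φ z + dzbar (f.coeff φ) z))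
  rw [(dz_mul hdρ hcf).1, (dz_conj hf).1, map_add]
  field_simp
  ring

theorem normSq_hopf (κ : ℝ) (g : ConformalMetric X) (β : BeltramiForm X)
    (u : C^∞⟮𝓘(ℝ, ℂ), X; ℝ⟯) (f : VectorField X) (x : X) :
    (hopf g β u f).normSq κ (g.expMul u) x = (β + f.dbar).normSq κ g x := by
  have hφ := chart_mem_atlas ℂ x
  have hx := mem_chart_target ℂ x
  have hρ := (g.pos _ hφ _ hx).ne'
  have h2 : (2 : ℤ) + 0 = ((2 : ℕ) : ℤ) := by norm_num
  have h0 : (-1 : ℤ) + 1 = 0 := by norm_num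
  simp only [Tensor.normSq, ConformalMetric.expMul]
  rw [hopf_coeff g β u f hφ hx, h2, h0, zpow_natCast, zpow_zero, norm_mul, norm_mul,
    Complex.norm_real, Complex.norm_real, RCLike.norm_conj, mul_pow, mul_pow, mul_pow,
    Real.norm_eq_abs, Real.norm_eq_abs, sq_abs, sq_abs]
  have he := (Real.exp_pos (2 * u ((chartAt ℂ x).symm (chartAt ℂ x x)))).ne'
  field_simp

/-- This is `log (e^{2u} ρ) = 2u + log ρ` under the Laplacian. -/
theorem curvature_expMul (g : ConformalMetric X) (u : C^∞⟮𝓘(ℝ, ℂ), X; ℝ⟯) (x : X) :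
    Real.exp (2 * u x) * (g.expMul u).curvature x = g.curvature x -
      Laplacian.laplacian (fun w => u ((chartAt ℂ x).symm w)) (chartAt ℂ x x) /
        g.ρ (chartAt ℂ x) (chartAt ℂ x x) := by
  set φ := chartAt ℂ x
  have hφ : φ ∈ atlas ℂ X := chart_mem_atlas ℂ x
  have hx : φ x ∈ φ.target := mem_chart_target ℂ x
  have hρ := (g.pos _ hφ _ hx).ne'
  have hsymm : φ.symm (φ x) = x := φ.left_inv (mem_chart_source ℂ x)
  have hu2 : ContDiffAt ℝ 2 (fun w => u (φ.symm w)) (φ x) :=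
    ((contDiffOn_comp_symm u hφ).contDiffAt (φ.open_target.mem_nhds hx)).of_le ENat.LEInfty.out
  have hsm : ContDiffAt ℝ 2 ((2 : ℝ) • fun w => u (φ.symm w)) (φ x) := contDiffAt_const.smul hu2
  have he : (fun w => Real.log ((g.expMul u).ρ φ w)) =ᶠ[nhds (φ x)]
      ((2 : ℝ) • fun w => u (φ.symm w)) + fun w => Real.log (g.ρ φ w) := by
    filter_upwards [φ.open_target.mem_nhds hx] with w hw
    simp only [ConformalMetric.expMul, Pi.add_apply, Pi.smul_apply, smul_eq_mul]
    rw [Real.log_mul (Real.exp_pos _).ne' (g.pos φ hφ w hw).ne', Real.log_exp]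
  have hρ' : (g.expMul u).ρ φ (φ x) = Real.exp (2 * u x) * g.ρ φ (φ x) := by
    simp only [ConformalMetric.expMul, hsymm]
  have hexp := (Real.exp_pos (2 * u x)).ne'
  have hg : g.curvature x = -Laplacian.laplacian (fun w => Real.log (g.ρ φ w)) (φ x) /
      (2 * g.ρ φ (φ x)) := rfl
  rw [hg, ConformalMetric.curvature, hρ',
    (InnerProductSpace.laplacian_congr_nhds he).eq_of_nhds,
    hsm.laplacian_add (g.contDiffAt_log hφ hx), InnerProductSpace.laplacian_smul _ hu2, smul_eq_mul]
  field_simp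
  ring

/-- The defect `e^{2u} (K(h) - λ + 2 |α|²_h)` in the Gauss equation for `h = e^{2u} g`. -/
def gaussDefect (κ lam : ℝ) (g : ConformalMetric X) (β : BeltramiForm X)
    (u : C^∞⟮𝓘(ℝ, ℂ), X; ℝ⟯) (f : VectorField X) (x : X) : ℝ :=
  Real.exp (2 * u x) * ((g.expMul u).curvature x -
    (lam - 2 * (hopf g β u f).normSq κ (g.expMul u) x))

theorem gaussEquation_iff (κ lam : ℝ) (g : ConformalMetric X) (β : BeltramiForm X)
    (u : C^∞⟮𝓘(ℝ, ℂ), X; ℝ⟯) (f : VectorField X) :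
    GaussEquation κ lam (g.expMul u) (hopf g β u f) ↔ ∀ x, gaussDefect κ lam g β u f x = 0 := by
  refine forall_congr' fun x => ?_
  rw [gaussDefect, mul_eq_zero, or_iff_right (Real.exp_pos _).ne', sub_eq_zero]

/-- Smoothness is what admits the defect itself as a direction `v`. -/
theorem contMDiff_gaussDefect (κ lam : ℝ) (g : ConformalMetric X) (β : BeltramiForm X)
    (u : C^∞⟮𝓘(ℝ, ℂ), X; ℝ⟯) (f : VectorField X) :
    ContMDiff 𝓘(ℝ, ℂ) 𝓘(ℝ) ∞ (gaussDefect κ lam g β u f) := by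
  refine contMDiff_of_comp_symm fun φ hφ => ?_
  have h1 : ContDiffOn ℝ ∞ (fun z => (hopf g β u f).normSq κ (g.expMul u) (φ.symm z))
      φ.target := by
    simp only [normSq_hopf]
    refine ContDiffOn.congr (f := fun z => κ * ‖(β + f.dbar).coeff φ z‖ ^ 2) ?_ fun z hz => ?_
    · exact contDiffOn_const.mul (((β + f.dbar).smooth φ hφ).norm_sq ℝ)
    · rw [Tensor.normSq_symm κ g _ hφ hz]
      simp
  exact ((contDiffOn_const.mul (contDiffOn_comp_symm u hφ)).exp).mul
    (((g.expMul u).contDiffOn_curvature_symm hφ).sub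
      (contDiffOn_const.sub (contDiffOn_const.mul h1)))

/-- Pointwise integration by parts. The Leibniz rule for `∂̄(v ∂u)` trades `⟨∂u, ∂v⟩` for `-v Δu/ρ`,
which completes `v K(g)` to `v e^{2u} K(h)`. The rule for `∂̄(α · w)` moves `∂̄` from `w` to `α`.
The last bracket collects the exact terms. -/
theorem integrandDeriv_eq (κ lam : ℝ) (g : ConformalMetric X) (β : BeltramiForm X)
    (u v : C^∞⟮𝓘(ℝ, ℂ), X; ℝ⟯) (f w : VectorField X) (x : X) :
    integrandDeriv κ lam g β u v f w x = v x * gaussDefect κ lam g β u f x -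
      2 * κ * (((hopf g β u f).dbar.contract w).density g x).re +
      (4 * (((del u).smulFun v).dbar.density g x).re +
        2 * κ * (((hopf g β u f).contract w).dbar.density g x).re) := by
  have hgd : gaussDefect κ lam g β u f x = Real.exp (2 * u x) * (g.expMul u).curvature x -
      Real.exp (2 * u x) * (lam - 2 * (β + f.dbar).normSq κ g x) := by
    rw [gaussDefect, normSq_hopf]; ring
  rw [hgd, curvature_expMul]
  simp only [integrandDeriv, Tensor.innerAt, Tensor.density]
  set φ := chartAt ℂ x
  have hφ : φ ∈ atlas ℂ X := chart_mem_atlas ℂ x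
  have hx : φ x ∈ φ.target := mem_chart_target ℂ x
  have hρ := (g.pos _ hφ _ hx).ne'
  have hsymm : φ.symm (φ x) = x := φ.left_inv (mem_chart_source ℂ x)
  have hu2 : ContDiffAt ℝ 2 (fun w => u (φ.symm w)) (φ x) :=
    ((contDiffOn_comp_symm u hφ).contDiffAt (φ.open_target.mem_nhds hx)).of_le ENat.LEInfty.out
  have hlap : (dzbar ((del u).coeff φ) (φ x)) =
      ((Laplacian.laplacian (fun w => u (φ.symm w)) (φ x) / 4 : ℝ) : ℂ) := by
    push_cast
    rw [ofReal_laplacian hu2]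
    simp only [del]
    ring
  have e1 : ((del u).smulFun v).dbar.coeff φ (φ x) =
      (starRingEnd ℂ) ((del v).coeff φ (φ x)) * (del u).coeff φ (φ x) +
        (v x : ℂ) * ((Laplacian.laplacian (fun w => u (φ.symm w)) (φ x) / 4 : ℝ) : ℂ) := by
    rw [← hlap]
    change dzbar (fun z => (v (φ.symm z) : ℂ) * (del u).coeff φ z) (φ x) = _
    rw [(dz_mul (differentiableAt_ofReal_comp_symm v hφ hx)
      ((del u).differentiableAt hφ hx)).2, dz_ofReal (differentiableAt_comp_symm v hφ hx), hsymm]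
    rfl
  have e2 : ((hopf g β u f).contract w).dbar.coeff φ (φ x) =
      ((hopf g β u f).dbar.contract w).coeff φ (φ x) +
        (Real.exp (2 * u x) : ℂ) * ((g.ρ φ (φ x) : ℂ) *
          (starRingEnd ℂ) ((β + f.dbar).coeff φ (φ x))) * w.dbar.coeff φ (φ x) := by
    have h := hopf_coeff g β u f hφ hx
    rw [hsymm] at h
    rw [← h]
    exact (dz_mul ((hopf g β u f).differentiableAt hφ hx) (w.differentiableAt hφ hx)).2
  rw [e1, e2]
  have h20 : (1 : ℤ) + 0 = 1 := by norm_num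
  have h0 : (-1 : ℤ) + 1 = 0 := by norm_num
  simp only [h20, h0, zpow_one, zpow_zero, Complex.div_ofReal_re, Complex.add_re, Complex.mul_re,
    Complex.mul_im, Complex.conj_re, Complex.conj_im, Complex.ofReal_re, Complex.ofReal_im]
  field_simp
  ring

theorem density_contract_dbar_of_isHolomorphic (g : ConformalMetric X)
    {α : QuadraticDifferential X} (hα : α.IsHolomorphic) (w : VectorField X) (x : X) :
    (α.dbar.contract w).density g x = 0 := by
  have h : (α.dbar.contract w).coeff (chartAt ℂ x) (chartAt ℂ x x) = 0 := by
    change dzbar (α.coeff (chartAt ℂ x)) (chartAt ℂ x x) * _ = 0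
    rw [α.isHolomorphic_iff.1 hα _ (chart_mem_atlas ℂ x) _ (mem_chart_target ℂ x), zero_mul]
  rw [Tensor.density, h, zero_div]

variable [CompactSpace X] [MeasurableSpace X] [BorelSpace X]

theorem integrable_area (g : ConformalMetric X) {E : Type*} [NormedAddCommGroup E]
    [SecondCountableTopology E] {G : X → E} (hG : Continuous G) : Integrable G g.area :=
  hG.integrable_of_hasCompactSupport (HasCompactSupport.of_compactSpace _)

variable [T2Space X]

/-- The first variation of the functional. -/
theorem hasDerivAt_donaldson_firstVariation (κ lam C : ℝ) (g : ConformalMetric X)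
    (β : BeltramiForm X) (u v : C^∞⟮𝓘(ℝ, ℂ), X; ℝ⟯) (f w : VectorField X) :
    HasDerivAt (fun t : ℝ => donaldson κ lam C g β (u + t • v) (f + t • w))
      ((∫ x, v x * gaussDefect κ lam g β u f x ∂g.area) -
        2 * κ * ∫ x, (((hopf g β u f).dbar.contract w).density g x).re ∂g.area) 0 := by
  refine (hasDerivAt_donaldson κ lam C g β u v f w).congr_deriv ?_
  have hre : ∀ S : Tensor X 1 1, Integrable (fun x => (S.density g x).re) g.area := fun S =>
    integrable_area g (Complex.continuous_re.comp (S.continuous_density g))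
  have hst : ∀ T : OneForm X, ∫ x, (T.dbar.density g x).re ∂g.area = 0 := fun T => by
    have h := integral_re (integrable_area g (T.dbar.continuous_density g))
    simp only [RCLike.re_to_complex] at h
    rw [h, T.integral_density_dbar g, Complex.zero_re]
  have hP : Integrable (fun x => v x * gaussDefect κ lam g β u f x) g.area :=
    integrable_area g
      (v.contMDiff.continuous.mul (contMDiff_gaussDefect κ lam g β u f).continuous)
  have h1 := (hre ((hopf g β u f).dbar.contract w)).const_mul (2 * κ)
  have h2 := (hre ((del u).smulFun v).dbar).const_mul 4
  have h3 := (hre ((hopf g β u f).contract w).dbar).const_mul (2 * κ)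
  simp only [integrandDeriv_eq]
  rw [integral_add (by exact hP.sub h1) (by exact h2.add h3), integral_sub hP h1,
    integral_add h2 h3, integral_const_mul, integral_const_mul, integral_const_mul, hst, hst]
  ring

theorem hasDerivAt_donaldson_metric (κ lam C : ℝ) (g : ConformalMetric X)
    (β : BeltramiForm X) (u v : C^∞⟮𝓘(ℝ, ℂ), X; ℝ⟯) (f : VectorField X) :
    HasDerivAt (fun t : ℝ => donaldson κ lam C g β (u + t • v) f)
      (∫ x, v x * gaussDefect κ lam g β u f x ∂g.area) 0 := by
  have h := hasDerivAt_donaldson_firstVariation κ lam C g β u v f 0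
  simp only [Tensor.add_smul_zero] at h
  refine h.congr_deriv ?_
  have h0 : ∀ x, ((hopf g β u f).dbar.contract (0 : VectorField X)).density g x = 0 := fun x => by
    have : ((hopf g β u f).dbar.contract (0 : VectorField X)).coeff (chartAt ℂ x)
        (chartAt ℂ x x) = 0 := mul_zero _
    rw [Tensor.density, this, zero_div]
  simp [h0]

theorem hasDerivAt_donaldson_vectorField (κ lam C : ℝ) (g : ConformalMetric X)
    (β : BeltramiForm X) (u : C^∞⟮𝓘(ℝ, ℂ), X; ℝ⟯) (f w : VectorField X) :
    HasDerivAt (fun t : ℝ => donaldson κ lam C g β u (f + t • w))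
      (-(2 * κ * ∫ x, (((hopf g β u f).dbar.contract w).density g x).re ∂g.area)) 0 := by
  have h := hasDerivAt_donaldson_firstVariation κ lam C g β u 0 f w
  simpa using h

theorem gaussEquation_iff_hasDerivAt (κ lam C : ℝ) (g : ConformalMetric X)
    (β : BeltramiForm X) (u : C^∞⟮𝓘(ℝ, ℂ), X; ℝ⟯) (f : VectorField X) :
    (∀ v : C^∞⟮𝓘(ℝ, ℂ), X; ℝ⟯,
        HasDerivAt (fun t : ℝ => donaldson κ lam C g β (u + t • v) f) 0 0) ↔
      GaussEquation κ lam (g.expMul u) (hopf g β u f) := by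
  rw [gaussEquation_iff]
  constructor
  · intro h x
    have hP := contMDiff_gaussDefect κ lam g β u f
    -- The direction is the defect, so the vanishing derivative is the integral of its square.
    have h1 := (hasDerivAt_donaldson_metric κ lam C g β u ⟨_, hP⟩ f).unique (h ⟨_, hP⟩)
    exact mul_self_eq_zero.1 (eq_zero_of_integral_eq_zero g.area
      (hP.continuous.mul hP.continuous) (fun y => mul_self_nonneg _) h1 x)
  · intro h v
    simpa [h] using hasDerivAt_donaldson_metric κ lam C g β u v f

theorem isHolomorphic_hopf_iff_hasDerivAt {κ : ℝ} (hκ : 0 < κ) (lam C : ℝ)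
    (g : ConformalMetric X) (β : BeltramiForm X) (u : C^∞⟮𝓘(ℝ, ℂ), X; ℝ⟯) (f : VectorField X) :
    (∀ w : VectorField X,
        HasDerivAt (fun t : ℝ => donaldson κ lam C g β u (f + t • w)) 0 0) ↔
      (hopf g β u f).IsHolomorphic := by
  constructor
  · intro h
    set S := (hopf g β u f).dbar with hS
    -- With `w` the metric dual of `∂̄α`, the derivative is `-2κ ∫ |∂̄α|²`, and `κ ≠ 0` can be
    -- divided out.
    have h1 := (hasDerivAt_donaldson_vectorField κ lam C g β u f (S.sharp g)).unique (h _)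
    simp only [← hS, Tensor.density_contract_sharp, Complex.ofReal_re, neg_eq_zero,
      mul_eq_zero, hκ.ne', two_ne_zero, false_or] at h1
    have hnn : ∀ x, 0 ≤ S.normSq 1 g x := fun x =>
      div_nonneg (by positivity)
        (zpow_nonneg (g.pos _ (chart_mem_atlas ℂ x) _ (mem_chart_target ℂ x)).le _)
    have h2 := eq_zero_of_integral_eq_zero g.area (S.continuous_normSq 1 g) hnn h1
    refine (Tensor.isHolomorphic_iff _).2 fun φ hφ z hz => ?_
    have h3 := h2 (φ.symm z)
    rw [S.normSq_symm 1 g hφ hz, div_eq_zero_iff,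
      or_iff_left (zpow_ne_zero _ (g.pos φ hφ z hz).ne'), one_mul] at h3
    exact norm_eq_zero.1 (pow_eq_zero_iff two_ne_zero |>.1 h3)
  · intro h w
    simpa [density_contract_dbar_of_isHolomorphic g h] using
      hasDerivAt_donaldson_vectorField κ lam C g β u f w

theorem isCritical_iff_gaussCodazzi {κ : ℝ} (hκ : 0 < κ) (lam C : ℝ)
    (g : ConformalMetric X) (β : BeltramiForm X) (u : C^∞⟮𝓘(ℝ, ℂ), X; ℝ⟯) (f : VectorField X) :
    GaussCodazzi κ lam (g.expMul u) (hopf g β u f) ↔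
      IsCritical (donaldson κ lam C g β) u f := by
  constructor
  · rintro ⟨hα, hG⟩ v w
    rw [gaussEquation_iff] at hG
    simpa [hG, density_contract_dbar_of_isHolomorphic g hα] using
      hasDerivAt_donaldson_firstVariation κ lam C g β u v f w
  · intro h
    -- The directions `(0, w)` and `(v, 0)` already separate the two equations.
    refine ⟨(isHolomorphic_hopf_iff_hasDerivAt hκ lam C g β u f).1 fun w => ?_,
      (gaussEquation_iff_hasDerivAt κ lam C g β u f).1 fun v => ?_⟩
    · simpa using h 0 w
    · simpa [Tensor.add_smul_zero] using h v 0

end EulerLagrange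

end CMC

end

theorem mainTheorem3 {X : Type*} [TopologicalSpace X] [T2Space X] [CompactSpace X]
    [ChartedSpace ℂ X] [IsManifold 𝓘(ℂ) ω X] [MeasurableSpace X] [BorelSpace X]
    (g : CMC.ConformalMetric X) (β : CMC.BeltramiForm X)
    (κ lam C : ℝ) (hκ : 0 < κ)
    (u : C^∞⟮𝓘(ℝ, ℂ), X; ℝ⟯) (f : CMC.VectorField X) :
    MeasureTheory.Integrable (CMC.integrand κ lam g β u f) g.area ∧
    (CMC.GaussCodazzi κ lam (g.expMul u) (CMC.hopf g β u f) ↔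
      CMC.IsCritical (CMC.donaldson κ lam C g β) u f) ∧
    ((∀ w : CMC.VectorField X,
        HasDerivAt (fun t : ℝ => CMC.donaldson κ lam C g β u (f + t • w)) 0 0) ↔
      (CMC.hopf g β u f).IsHolomorphic) ∧
    ((∀ v : C^∞⟮𝓘(ℝ, ℂ), X; ℝ⟯,
        HasDerivAt (fun t : ℝ => CMC.donaldson κ lam C g β (u + t • v) f) 0 0) ↔
      CMC.GaussEquation κ lam (g.expMul u) (CMC.hopf g β u f)) := by
  exact ⟨CMC.integrable_area g (CMC.continuous_integrand κ lam g β u f),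
    CMC.isCritical_iff_gaussCodazzi hκ lam C g β u f,
    CMC.isHolomorphic_hopf_iff_hasDerivAt hκ lam C g β u f,
    CMC.gaussEquation_iff_hasDerivAt κ lam C g β u f⟩
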